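/- A computable metric space is a metric space $(X,d)$ with a dense sequence $(s_i)_{i\ge 0}$ of ideal points whose distances $d(s_i,s_j)$ are computable uniformly in $i,j$; an ideal ball is an open ball centred at an ideal point with positive rational radius. A map $f:X\to X$ is computable if the preimage of an ideal ball $B$ is a union of ideal balls that can be enumerated by an algorithm, uniformly in $B$; a closed set $K\subset X$ is effective if $X\setminus K$ is the union of a recursively enumerable family of ideal balls. A computable dynamical system $(K,f)$ consists of a computable (hence continuous) map $f:X\to X$ and an effective compact set $K\subset X$ with $f(K)\subset K$. For a finite nonempty alphabet $\mathcal A$, the space $\mathcal A^{\mathbb N}$ is given its usual metric, $d(x,y)=2^{-\min\{n\,:\,x_n\ne y_n\}}$ for $x\neq y$, and as ideal points the sequences $w\,a\,a\,a\cdots$, where $w$ is a finite word over $\mathcal A$ and $a\in\mathcal A$ is a fixed letter. For an open cover $\mathcal U$ of $K$ and $n\ge 1$, let $N_n(K,f,\mathcal U)$ be the least cardinality of a subfamily of $\bigvee_{k=0}^{n-1} f^{-k}(\mathcal U)$ that covers $K$. The topological entropy is $$h(K,f)=\sup_{\mathcal U}\ \inf_{n\ge 1}\ \frac{\log_2 N_n(K,f,\mathcal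 U)}{n}\in[0,+\infty],$$ where $\mathcal U$ ranges over the finite open covers of $K$. A real number $h$ is $\Sigma_2$-computable if there is a computable double sequence of rationals $(q_{ij})$ with $h=\sup_i\inf_j q_{ij}$. **Proposition.** Let $h\ge 0$ be a real number. There exist a finite nonempty alphabet $\mathcal A$ and a computable dynamical system $(\mathcal A^{\mathbb N},f)$ (that is, with $K=X=\mathcal A^{\mathbb N}$) whose topological entropy is $h$ if and only if $h$ is $\Sigma_2$-computable. -/

import Mathlib

namespace CompDyn

/-- The rational number `(a - b) / (c + 1)` coded by a triple of natural numbers. -/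
def ratOfCode (t : ℕ × ℕ × ℕ) : ℚ := ((t.1 : ℚ) - (t.2.1 : ℚ)) / ((t.2.2 : ℚ) + 1)

/-- A family of rationals is computable if an algorithm outputs, for each index, a numerator
(as a difference of two natural numbers) and a nonzero denominator of the corresponding term. -/
def ComputableRat {α : Type*} [Primcodable α] (q : α → ℚ) : Prop :=
  ∃ c : α → ℕ × ℕ × ℕ, Computable c ∧ ∀ x, q x = ratOfCode (c x)

/-- `x` is `Σ₂`-computable: `x = sup_i inf_j q i j` for a computable double sequence of rationals.
The supremum and the infima are taken in the extended reals, so no junk value is involved. -/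
def IsSigmaTwo (x : ℝ) : Prop :=
  ∃ q : ℕ × ℕ → ℚ, ComputableRat q ∧
    (x : EReal) = ⨆ i : ℕ, ⨅ j : ℕ, (((q (i, j) : ℚ) : ℝ) : EReal)

/-- A computable metric space structure on a metric space: a dense sequence of ideal points
whose mutual distances are uniformly computable. -/
structure CompMetric (X : Type*) [MetricSpace X] where
  /-- the enumeration of the ideal points -/
  pt : ℕ → X
  dense : DenseRange pt
  dist_computable : ∃ r : ℕ × ℕ × ℕ → ℚ, ComputableRat r ∧
    ∀ i j n : ℕ, |dist (pt i) (pt j) - ((r (i, j, n) : ℚ) : ℝ)| ≤ ((2 : ℝ) ^ n)⁻¹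

section Computability

variable {X : Type*} [MetricSpace X] {Y : Type*} [MetricSpace Y]

/-- The ideal ball with code `(i, a, b)`: its centre is the `i`-th ideal point, and its radius
is the positive rational number `(a + 1) / (b + 1)`. -/
def idealBall (S : CompMetric X) (c : ℕ × ℕ × ℕ) : Set X :=
  Metric.ball (S.pt c.1) (((c.2.1 : ℝ) + 1) / ((c.2.2 : ℝ) + 1))

/-- The union of the ideal balls whose codes belong to `I`. -/
def ballUnion (S : CompMetric X) (I : Set (ℕ × ℕ × ℕ)) : Set X := ⋃ c ∈ I, idealBall S c

/-- `K` is effective: its complement is the union of a recursively enumerable family of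
ideal balls. -/
def IsEffective (S : CompMetric X) (K : Set X) : Prop :=
  ∃ I : Set (ℕ × ℕ × ℕ), REPred (fun c => c ∈ I) ∧ Kᶜ = ballUnion S I

/-- `f` is computable: the preimage of the ideal ball with code `m` is the union of a family of
ideal balls that is recursively enumerable uniformly in `m`. -/
def IsComputableMap (S : CompMetric X) (T : CompMetric Y) (f : X → Y) : Prop :=
  ∃ I : ℕ × ℕ × ℕ → Set (ℕ × ℕ × ℕ),
    REPred (fun p : (ℕ × ℕ × ℕ) × (ℕ × ℕ × ℕ) => p.2 ∈ I p.1) ∧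
      ∀ m, f ⁻¹' idealBall T m = ballUnion S (I m)

end Computability

section Entropy

variable {X : Type*} [TopologicalSpace X]

/-- `(K, f)` is a dynamical system on `X`. -/
structure IsDynamicalSystem (K : Set X) (f : X → X) : Prop where
  continuous : Continuous f
  isCompact : IsCompact K
  mapsTo : Set.MapsTo f K K

/-- `𝒰` is a cover of `K` by open subsets of `X`. -/
def IsCover (K : Set X) (𝒰 : Set (Set X)) : Prop :=
  (∀ U ∈ 𝒰, IsOpen U) ∧ K ⊆ ⋃₀ 𝒰

/-- The join of the collections `f^{-k}(𝒰)` for `0 ≤ k ≤ n - 1`: the collection of all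
intersections `⋂_{k < n} f^{-k}(U_k)` with every `U_k` in `𝒰`. -/
def iterJoin (f : X → X) (𝒰 : Set (Set X)) (n : ℕ) : Set (Set X) :=
  {W | ∃ u : ℕ → Set X, (∀ k < n, u k ∈ 𝒰) ∧ W = ⋂ k < n, f^[k] ⁻¹' u k}

/-- The minimal cardinality of a (finite) sub-cover of `K` extracted from the join of the
`f^{-k}(𝒰)`, `0 ≤ k ≤ n - 1`. -/
noncomputable def coverNumber (K : Set X) (f : X → X) (𝒰 : Set (Set X)) (n : ℕ) : ℕ :=
  sInf {m : ℕ | ∃ 𝒱 : Set (Set X), 𝒱 ⊆ iterJoin f 𝒰 n ∧ IsCover K 𝒱 ∧ 𝒱.Finite ∧ 𝒱.ncard = m}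

/-- The entropy relative to the open cover `𝒰`: `inf_{n ≥ 1} log₂ (N_n(K, f, 𝒰)) / n`. -/
noncomputable def coverEntropyRel (K : Set X) (f : X → X) (𝒰 : Set (Set X)) : ℝ :=
  ⨅ n : ℕ, Real.logb 2 (coverNumber K f 𝒰 (n + 1) : ℝ) / ((n : ℝ) + 1)

/-- Topological entropy (in base 2): the supremum, possibly `⊤`, of the entropies relative to
the finite open covers of `K`. -/
noncomputable def topEntropy (K : Set X) (f : X → X) : EReal :=
  ⨆ (𝒰 : Set (Set X)) (_ : 𝒰.Finite ∧ IsCover K 𝒰), (coverEntropyRel K f 𝒰 : EReal)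

end Entropy

/-- `(K, f)` is a computable dynamical system on the computable metric space `X`. -/
structure IsComputableSystem {X : Type*} [MetricSpace X] (S : CompMetric X)
    (K : Set X) (f : X → X) : Prop where
  isDynamicalSystem : IsDynamicalSystem K f
  computable : IsComputableMap S S f
  effective : IsEffective S K

/-- The space of one-sided infinite sequences over `A`. -/
def CantorSpace (A : Type*) : Type _ := ℕ → A

/-- The usual metric: distinct sequences `x`, `y` are at distance `2⁻ⁿ`, where `n` is the least
index with `x n ≠ y n`. -/
noncomputable instance instMetricSpaceCantor (A : Type*) : MetricSpace (CantorSpace A) :=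
  letI : TopologicalSpace A := ⊥
  haveI : DiscreteTopology A := ⟨rfl⟩
  PiNat.metricSpace (E := fun _ : ℕ => A)

/-- The `i`-th ideal point `w a a a …`, where `w` is the word over `A` with code `i`
(the empty word if `i` is not a code). -/
def cantorPt (A : Type*) [Primcodable A] (a : A) (i : ℕ) : CantorSpace A :=
  fun n => ((Encodable.decode (α := List A) i).getD []).getD n a

theorem cantor_dist_eq {A : Type*} {x y : CantorSpace A} (h : x ≠ y) :
    dist x y = (1 / 2 : ℝ) ^ PiNat.firstDiff (E := fun _ : ℕ => A) x y :=
  PiNat.dist_eq_of_ne (E := fun _ : ℕ => A) h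

theorem cantor_dist_le {A : Type*} {x y : CantorSpace A} {n : ℕ} (h : ∀ k < n, x k = y k) :
    dist x y ≤ (1 / 2 : ℝ) ^ n :=
  (PiNat.mem_cylinder_iff_dist_le (E := fun _ : ℕ => A) (x := y) (y := x)).1
    (fun k hk => h k hk)

theorem cantorPt_encode {A : Type*} [Primcodable A] (a : A) (y : ℕ → A) {n k : ℕ} (hk : k < n) :
    cantorPt A a (Encodable.encode ((List.range n).map y)) k = y k := by
  have h : ((List.range n).map y).getD k a = y k := by simp [hk]
  rw [cantorPt, Encodable.encodek]
  exact h

theorem cantorPt_denseRange (A : Type*) [Primcodable A] (a : A) :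
    DenseRange (cantorPt A a) := by
  rw [Metric.denseRange_iff]
  intro x r hr
  obtain ⟨n, hn⟩ := exists_pow_lt_of_lt_one hr (by norm_num : (1 / 2 : ℝ) < 1)
  let y : ℕ → A := x
  refine ⟨Encodable.encode ((List.range n).map y), lt_of_le_of_lt (cantor_dist_le ?_) hn⟩
  intro k hk
  exact (cantorPt_encode a y hk).symm

theorem cantorPt_dist_computable (A : Type*) [Primcodable A] (a : A) :
    ∃ r : ℕ × ℕ × ℕ → ℚ, ComputableRat r ∧ ∀ i j n : ℕ,
      |dist (cantorPt A a i) (cantorPt A a j) - ((r (i, j, n) : ℚ) : ℝ)| ≤ ((2 : ℝ) ^ n)⁻¹ := by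
  classical
  let w : ℕ → List A := fun i => (Encodable.decode (α := List A) i).getD []
  let d : ℕ × ℕ × ℕ → ℕ := fun p =>
    (List.range p.2.2).findIdx fun m => !((w p.1).getD m a == (w p.2.1).getD m a)
  have hw : Primrec w := Primrec.option_getD.comp Primrec.decode (Primrec.const [])
  have hd : Primrec d := by
    refine Primrec.list_findIdx (Primrec.list_range.comp (Primrec.snd.comp Primrec.snd)) ?_
    refine Primrec.not.comp (Primrec.beq.comp ?_ ?_)
    · exact (Primrec.list_getD a).comp (hw.comp (Primrec.fst.comp Primrec.fst)) Primrec.snd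
    · exact (Primrec.list_getD a).comp
        (hw.comp (Primrec.fst.comp (Primrec.snd.comp Primrec.fst))) Primrec.snd
  have hpow : Primrec (fun k : ℕ => 2 ^ k - 1) := by
    have h2 : Primrec (fun k : ℕ => 2 ^ k) := by
      refine (Primrec.nat_rec₁ 1 (f := fun _ y => 2 * y)
        (Primrec.nat_mul.comp (Primrec.const 2) Primrec.snd).to₂).of_eq ?_
      intro k
      induction k with
      | zero => rfl
      | succ k ih => simp only [] at ih ⊢; rw [ih]; ring
    exact Primrec.nat_sub.comp h2 (Primrec.const 1)
  refine ⟨fun p => ratOfCode (1, 0, 2 ^ d p - 1), ⟨fun p => (1, 0, 2 ^ d p - 1), ?_,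
    fun _ => rfl⟩, ?_⟩
  · exact ((Primrec.const 1).pair ((Primrec.const 0).pair (hpow.comp hd))).to_comp
  intro i j n
  have hr : ((ratOfCode (1, 0, 2 ^ d (i, j, n) - 1) : ℚ) : ℝ) = (1 / 2 : ℝ) ^ d (i, j, n) := by
    have h1 : (1 : ℕ) ≤ 2 ^ d (i, j, n) := Nat.one_le_two_pow
    simp [ratOfCode, Nat.cast_sub h1]
  rw [hr]
  have hdn : d (i, j, n) ≤ n := by
    exact (List.findIdx_le_length (xs := List.range n)
      (p := fun m => !((w i).getD m a == (w j).getD m a))).trans (by simp)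
  have heq : ∀ k < d (i, j, n), cantorPt A a i k = cantorPt A a j k := by
    intro k hk
    have := List.not_of_lt_findIdx hk
    simp only [List.getElem_range, Bool.not_eq_false', beq_iff_eq] at this
    exact this
  have hle : dist (cantorPt A a i) (cantorPt A a j) ≤ (1 / 2 : ℝ) ^ d (i, j, n) :=
    cantor_dist_le heq
  rcases hdn.lt_or_eq with hlt | he
  · have hlen : d (i, j, n) < (List.range n).length := by simpa using hlt
    have hne : cantorPt A a i (d (i, j, n)) ≠ cantorPt A a j (d (i, j, n)) := by
      have := List.findIdx_getElem (w := hlen)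
      simp only [List.getElem_range, Bool.not_eq_true', beq_eq_false_iff_ne] at this
      exact this
    have hne' : cantorPt A a i ≠ cantorPt A a j := fun h => hne (by rw [h])
    have hfd : PiNat.firstDiff (E := fun _ : ℕ => A) (cantorPt A a i) (cantorPt A a j)
        ≤ d (i, j, n) := by
      by_contra hc
      exact hne (PiNat.apply_eq_of_lt_firstDiff (E := fun _ : ℕ => A) (not_le.1 hc))
    have hge : (1 / 2 : ℝ) ^ d (i, j, n) ≤ dist (cantorPt A a i) (cantorPt A a j) := by
      rw [cantor_dist_eq hne']
      exact pow_le_pow_of_le_one (by norm_num) (by norm_num) hfd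
    rw [le_antisymm hle hge]
    simp
  · rw [he] at hle ⊢
    have h0 : 0 ≤ dist (cantorPt A a i) (cantorPt A a j) := dist_nonneg
    rw [one_div, inv_pow] at hle ⊢
    rw [abs_le]
    constructor <;> linarith [inv_nonneg.2 (pow_nonneg (zero_le_two (α := ℝ)) n)]

/-- The natural computable metric space structure on `A^ℕ`, with ideal points `w a a a …`. -/
def cantorComp (A : Type*) [Primcodable A] (a : A) : CompMetric (CantorSpace A) where
  pt := cantorPt A a
  dense := cantorPt_denseRange A a
  dist_computable := cantorPt_dist_computable A a

end CompDyn

/-! A Lebesgue number argument refines every open cover of `A^ℕ` by cylinders of some length `m`.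
Hence the entropy is `sup_m inf_n log₂ N(m, n) / n`, where `N(m, n)` counts the itineraries of
length `n` through the `m`-cylinders (`topEntropy_eq_iSup`).

Necessity: a computable `f` is approximated by a primitive recursive map `F` from prefixes to
prefixes (`IsComputableMap.exists_isApprox`). By compactness one prefix length serves all points, so
a finite check on words can certify that a list contains all itineraries. Rational upper bounds of
`log₂ N(m, n) / n` are thus enumerable, and the infimum over `n` is the infimum of a computable
sequence (`isSigmaTwo_of_topEntropy_eq`).

Sufficiency: let `h = sup_i x_i` with `x_i = inf_j q_ij`, and let `C > h` be an integer. In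
`gatedShift` a frozen layer holds `i`, a second layer is an odometer, and a third layer shifts
letters from an alphabet of size `2^C` through gates that let through a proportion of about `x_i /
C` of them. Since `x_i` is known only from above, column `k` uses the bounds found by stage `k`. A
letter moves one column left while the clock gains one, so clock plus column is invariant. Reversing
its lowest `j` bits gives the numerator `v` of a dyadic `v / 2^j`, refined as `j` grows, and gate
`j` asks whether `v / 2^j` lies below the current bound of `x_i / C`. Gates therefore weaken towards
the left, and a letter survives exactly when it passes the first one (`iterate_gatedShift_snd_snd`).
Any `2^j` consecutive columns realize each `v` once (`count_bitRev`), so open columns have an exact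
density. Index `i` contributes `x_i`, or zero if `x_i` is negative, which is harmless as `h ≥ 0`. -/

namespace CompDyn

open Filter Topology

/-! ### Prefixes, cylinders and ideal balls in sequence space -/

section Cylinders

variable {A : Type*}

theorem cantor_dist_le_iff {x y : CantorSpace A} {n : ℕ} :
    dist x y ≤ (1 / 2 : ℝ) ^ n ↔ ∀ k < n, x k = y k := by
  refine ⟨fun h => ?_, cantor_dist_le⟩
  have := (PiNat.mem_cylinder_iff_dist_le (E := fun _ : ℕ => A) (x := y) (y := x)).2 h
  exact fun k hk => this k hk

theorem cantor_dist_lt_iff {x y : CantorSpace A} {r : ℝ} (hr : 0 < r) :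
    dist x y < r ↔ ∃ k : ℕ, (∀ l < k, x l = y l) ∧ (1 / 2 : ℝ) ^ k < r := by
  constructor
  · intro h
    by_cases hxy : x = y
    · obtain ⟨n, hn⟩ := exists_pow_lt_of_lt_one hr (by norm_num : (1 / 2 : ℝ) < 1)
      exact ⟨n, fun l _ => by rw [hxy], hn⟩
    · rw [cantor_dist_eq hxy] at h
      exact ⟨_, fun l hl => PiNat.apply_eq_of_lt_firstDiff (E := fun _ : ℕ => A) hl, h⟩
  · rintro ⟨k, hk, hlt⟩
    exact (cantor_dist_le hk).trans_lt hlt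

/-- The word formed by the first `r` letters of `x`. -/
def pre (x : CantorSpace A) (r : ℕ) : List A := (List.range r).map x

@[simp] theorem length_pre (x : CantorSpace A) (r : ℕ) : (pre x r).length = r :=
  (List.length_map ..).trans List.length_range

theorem getElem?_pre (x : CantorSpace A) {r k : ℕ} (hk : k < r) : (pre x r)[k]? = some (x k) := by
  have h (y : ℕ → A) : ((List.range r).map y)[k]? = some (y k) := by simp [hk]
  exact h x

theorem getD_pre (x : CantorSpace A) {r k : ℕ} (hk : k < r) (a : A) :
    (pre x r).getD k a = x k := by
  simp [List.getD_eq_getElem?_getD, getElem?_pre x hk]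

theorem pre_congr {x y : CantorSpace A} {r : ℕ} (h : ∀ k < r, x k = y k) : pre x r = pre y r := by
  apply List.map_congr_left
  intro k hk
  exact h k (List.mem_range.1 hk)

theorem pre_eq_iff {x y : CantorSpace A} {r : ℕ} : pre x r = pre y r ↔ ∀ k < r, x k = y k := by
  refine ⟨fun h k hk => ?_, pre_congr⟩
  have : (pre x r)[k]? = (pre y r)[k]? := by rw [h]
  rw [getElem?_pre x hk, getElem?_pre y hk] at this
  exact Option.some_injective _ this

theorem take_pre (x : CantorSpace A) {r k : ℕ} (hk : k ≤ r) : (pre x r).take k = pre x k := by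
  have h (y : ℕ → A) : ((List.range r).map y).take k = (List.range k).map y := by
    simp [← List.map_take, List.take_range, hk]
  exact h x

theorem isOpen_of_agree {U : Set (CantorSpace A)}
    (h : ∀ x ∈ U, ∃ k : ℕ, ∀ y : CantorSpace A, (∀ l < k, y l = x l) → y ∈ U) : IsOpen U := by
  rw [Metric.isOpen_iff]
  intro x hx
  obtain ⟨k, hk⟩ := h x hx
  refine ⟨(1 / 2) ^ k, by positivity, fun y hy => hk y ?_⟩
  exact cantor_dist_le_iff.1 (le_of_lt hy)

theorem continuous_of_agree {f : CantorSpace A → CantorSpace A}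
    (h : ∀ k : ℕ, ∃ r : ℕ, ∀ x y : CantorSpace A, (∀ l < r, y l = x l) → ∀ l < k, f y l = f x l) :
    Continuous f := by
  rw [Metric.continuous_iff]
  intro x ε hε
  obtain ⟨k, hk⟩ := exists_pow_lt_of_lt_one hε (by norm_num : (1 / 2 : ℝ) < 1)
  obtain ⟨r, hr⟩ := h k
  refine ⟨(1 / 2) ^ r, by positivity, fun y hy => lt_of_le_of_lt (cantor_dist_le ?_) hk⟩
  exact hr x y (cantor_dist_le_iff.1 hy.le)

instance [Finite A] : CompactSpace (CantorSpace A) := by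
  let : TopologicalSpace A := ⊥
  have : DiscreteTopology A := ⟨rfl⟩
  exact inferInstanceAs (CompactSpace (ℕ → A))

variable [Primcodable A] {a : A}

theorem mem_idealBall_iff {x : CantorSpace A} {c : ℕ × ℕ × ℕ} :
    x ∈ idealBall (cantorComp A a) c ↔
      ∃ k : ℕ, (∀ l < k, x l = cantorPt A a c.1 l) ∧ c.2.2 + 1 < (c.2.1 + 1) * 2 ^ k := by
  rw [idealBall, Metric.mem_ball, cantor_dist_lt_iff (by positivity)]
  refine exists_congr fun k => and_congr Iff.rfl ?_
  rw [one_div, inv_pow, inv_lt_iff_one_lt_mul₀ (by positivity), div_mul_eq_mul_div,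
    one_lt_div (by positivity)]
  exact_mod_cast Iff.rfl

/-- This code gives radius `2 / 2^n`. Distances are zero or powers of `1/2`, so being below
`2^(1-n)` is the same as being at most `2^(-n)`. -/
theorem mem_idealBall_cylinder_iff {x : CantorSpace A} {i n : ℕ} :
    x ∈ idealBall (cantorComp A a) (i, 1, 2 ^ n - 1) ↔ ∀ l < n, x l = cantorPt A a i l := by
  have h1 : 2 ^ n - 1 + 1 = 2 ^ n := Nat.sub_add_cancel Nat.one_le_two_pow
  rw [mem_idealBall_iff]
  simp only [h1]
  constructor
  · rintro ⟨k, hk, hlt⟩ l hl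
    refine hk l (hl.trans_le ?_)
    have : 2 ^ n < 2 ^ (k + 1) := by rw [pow_succ]; omega
    exact Nat.lt_succ_iff.1 ((Nat.pow_lt_pow_iff_right (by norm_num)).1 this)
  · intro h
    exact ⟨n, h, by have := Nat.one_le_two_pow (n := n); omega⟩

theorem cantorPt_encode_pre (a : A) (x : CantorSpace A) {n k : ℕ} (hk : k < n) :
    cantorPt A a (Encodable.encode (pre x n)) k = x k :=
  cantorPt_encode a x hk

end Cylinders

/-! ### Primitive recursive stages of partial recursive objects -/

section Stages

variable {α σ : Type*} [Primcodable α] [Primcodable σ]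

open Encodable Nat.Partrec

theorem _root_.Partrec.exists_stage {f : α →. σ} (hf : Partrec f) :
    ∃ g : α × ℕ → Option σ, Primrec g ∧ ∀ a b, b ∈ f a ↔ ∃ s, g (a, s) = some b := by
  obtain ⟨c, hc⟩ := Code.exists_code.1 hf
  refine ⟨fun p => (Code.evaln p.2 c (encode p.1)).bind fun n => decode n, ?_, ?_⟩
  · refine Primrec.option_bind ?_ (Primrec.decode.comp Primrec.snd).to₂
    exact Code.primrec_evaln.comp
      ((Primrec.snd.pair (Primrec.const c)).pair (Primrec.encode.comp Primrec.fst))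
  · intro a b
    have h : encode b ∈ Code.eval c (encode a) ↔ b ∈ f a := by
      rw [hc]; simp
    rw [← h, Code.evaln_complete]
    refine exists_congr fun s => ?_
    constructor
    · intro h'
      simp [Option.mem_def.1 h']
    · intro h'
      obtain ⟨n, hn, hn'⟩ := Option.bind_eq_some_iff.1 h'
      have := Code.evaln_sound hn
      rw [hc] at this
      simp only [encodek, Part.coe_some, Part.bind_some, Part.mem_map_iff] at this
      obtain ⟨b', hb', rfl⟩ := this
      rw [encodek] at hn'
      cases hn'
      exact hn

theorem _root_.Computable.exists_stage {f : α → σ} (hf : Computable f) :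
    ∃ g : α × ℕ → Option σ, Primrec g ∧ (∀ a s b, g (a, s) = some b → b = f a) ∧
      ∀ a, ∃ s, g (a, s) = some (f a) := by
  obtain ⟨g, hg, h⟩ := Partrec.exists_stage hf.partrec
  refine ⟨g, hg, fun a s b hb => ?_, fun a => (h a _).1 (Part.mem_some _)⟩
  exact Part.mem_some_iff.1 ((h a b).2 ⟨s, hb⟩)

theorem _root_.REPred.exists_stage {p : α → Prop} (hp : REPred p) :
    ∃ g : α × ℕ → Prop, PrimrecPred g ∧ ∀ a, p a ↔ ∃ s, g (a, s) := by
  obtain ⟨g, hg, h⟩ := Partrec.exists_stage (show Partrec fun a => Part.assert (p a) fun _ => Part.some () from hp)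
  refine ⟨fun q => g q = some (), Primrec.eq.comp hg (Primrec.const _), fun a => ?_⟩
  rw [← h]
  simp

theorem _root_.PrimrecPred.to_re {p : α → Prop} (hp : PrimrecPred p) : REPred p :=
  ComputablePred.to_re (by obtain ⟨h, h'⟩ := hp; exact ⟨h, h'.to_comp⟩)

end Stages

/-! ### Entropy as a supremum over cylinder partitions -/

section EntropyFormula

variable {A : Type*}

instance [Nonempty A] : Nonempty (CantorSpace A) := inferInstanceAs (Nonempty (ℕ → A))

/-- The first `m` letters of `x, f x, …, f^{n-1} x`. -/
def itin (f : CantorSpace A → CantorSpace A) (m n : ℕ) (x : CantorSpace A) : Fin n → Fin m → A :=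
  fun k p => f^[k] x p

theorem itin_eq_iff {f : CantorSpace A → CantorSpace A} {m n : ℕ} {x y : CantorSpace A} :
    itin f m n x = itin f m n y ↔ ∀ k < n, ∀ p < m, f^[k] x p = f^[k] y p :=
  ⟨fun h k hk p hp => congrFun (congrFun h ⟨k, hk⟩) ⟨p, hp⟩,
    fun h => funext fun k => funext fun p => h k k.2 p p.2⟩

/-- The number of words of length `n` over the `m`-cylinders that are realized by an orbit. -/
noncomputable def itinCount (f : CantorSpace A → CantorSpace A) (m n : ℕ) : ℕ :=
  (Set.range (itin f m n)).ncard

/-- The partition of `A^ℕ` into cylinders of length `m`. -/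
def cylinders (A : Type*) (m : ℕ) : Set (Set (CantorSpace A)) :=
  Set.range fun w : Fin m → A => {x | ∀ p : Fin m, x p = w p}

theorem itinCount_pos [Finite A] [Nonempty A] (f : CantorSpace A → CantorSpace A) (m n : ℕ) :
    0 < itinCount f m n := by
  exact (Set.ncard_pos (Set.toFinite _)).2 (Set.range_nonempty _)

theorem itinCount_le_of_factor [Finite A] [Nonempty A] {f : CantorSpace A → CantorSpace A} {m n : ℕ}
    {γ : Type*} [Finite γ] (c : CantorSpace A → γ)
    (hc : ∀ x y, c x = c y → itin f m n x = itin f m n y) : itinCount f m n ≤ Nat.card γ := by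
  rw [← Set.ncard_univ]
  choose! g hg using fun t (ht : t ∈ Set.range (itin f m n)) => ht
  refine Set.ncard_le_ncard_of_injOn (fun t => c (g t)) (fun _ _ => Set.mem_univ _) ?_
    Set.finite_univ
  intro s hs t ht hst
  rw [← hg s hs, ← hg t ht]
  exact hc _ _ hst

theorem le_itinCount_of_injective [Finite A] {f : CantorSpace A → CantorSpace A} {m n : ℕ}
    {γ : Type*} (c : γ → CantorSpace A)
    (hc : ∀ s t, itin f m n (c s) = itin f m n (c t) → s = t) : Nat.card γ ≤ itinCount f m n := by
  rw [itinCount, ← Nat.card_coe_set_eq]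
  exact Nat.card_le_card_of_injective (fun s => (⟨_, c s, rfl⟩ : Set.range (itin f m n)))
    fun s t h => hc s t (congrArg Subtype.val h)

theorem isCover_cylinders (m : ℕ) : IsCover Set.univ (cylinders A m) := by
  refine ⟨?_, fun x _ => ⟨_, ⟨fun p => x p, rfl⟩, fun _ => rfl⟩⟩
  rintro _ ⟨w, rfl⟩
  exact isOpen_of_agree fun x hx => ⟨m, fun y hy p => (hy p p.2).trans (hx p)⟩

/-- Cylinders of length `m` are disjoint, so all points of one element of the join share their
itinerary, and a cover needs a separate element for each itinerary. -/
theorem itinCount_le_ncard [Nonempty A] {f : CantorSpace A → CantorSpace A} {m n : ℕ}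
    {𝒱 : Set (Set (CantorSpace A))} (h𝒱 : 𝒱 ⊆ iterJoin f (cylinders A m) n)
    (hc : IsCover Set.univ 𝒱) (hf : 𝒱.Finite) : itinCount f m n ≤ 𝒱.ncard := by
  choose V hV hxV using fun x => hc.2 (Set.mem_univ x)
  choose! g hg using fun t (ht : t ∈ Set.range (itin f m n)) => ht
  refine Set.ncard_le_ncard_of_injOn (fun t => V (g t)) (fun t _ => hV _) ?_ hf
  intro s hs t ht hst
  obtain ⟨u, hu, hW⟩ := h𝒱 (hV (g s))
  have h1 : g s ∈ V (g s) := hxV _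
  have h2 : g t ∈ V (g s) := by
    have := hxV (g t)
    simpa only [hst] using this
  rw [← hg s hs, ← hg t ht, itin_eq_iff]
  rw [hW] at h1 h2
  simp only [Set.mem_iInter, Set.mem_preimage] at h1 h2
  intro k hk p hp
  obtain ⟨w, hw⟩ := hu k hk
  have h1' := h1 k hk
  have h2' := h2 k hk
  rw [← hw] at h1' h2'
  exact (h1' ⟨p, hp⟩).trans (h2' ⟨p, hp⟩).symm

/-- One representative orbit is chosen per itinerary; the cover elements containing the
`m`-cylinders along that orbit contain those of every orbit with the same itinerary. -/
theorem exists_subcover_of_refines [Finite A] [Nonempty A] {f : CantorSpace A → CantorSpace A}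
    (hf : Continuous f) {𝒰 : Set (Set (CantorSpace A))} (h𝒰 : IsCover Set.univ 𝒰) {m : ℕ}
    (hm : ∀ x : CantorSpace A, ∃ U ∈ 𝒰, ∀ y : CantorSpace A, (∀ l < m, y l = x l) → y ∈ U)
    (n : ℕ) :
    ∃ 𝒱 ⊆ iterJoin f 𝒰 n, IsCover Set.univ 𝒱 ∧ 𝒱.Finite ∧ 𝒱.ncard ≤ itinCount f m n := by
  choose U hU hyU using hm
  choose! g hg using fun t (ht : t ∈ Set.range (itin f m n)) => ht
  let W : (Fin n → Fin m → A) → Set (CantorSpace A) := fun t =>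
    ⋂ k < n, f^[k] ⁻¹' U (f^[k] (g t))
  refine ⟨W '' Set.range (itin f m n), ?_, ⟨?_, ?_⟩, (Set.toFinite _).image _,
    Set.ncard_image_le (Set.toFinite _)⟩
  · rintro _ ⟨t, -, rfl⟩
    exact ⟨fun k => U (f^[k] (g t)), fun k _ => hU _, rfl⟩
  · rintro _ ⟨t, -, rfl⟩
    exact (Set.finite_lt_nat n).isOpen_biInter fun k _ =>
      (h𝒰.1 _ (hU _)).preimage (hf.iterate k)
  · intro x _
    refine ⟨W (itin f m n x), ⟨_, ⟨x, rfl⟩, rfl⟩, ?_⟩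
    simp only [W, Set.mem_iInter, Set.mem_preimage]
    intro k hk
    exact hyU _ _ fun p hp => (itin_eq_iff.1 (hg _ ⟨x, rfl⟩) k hk p hp).symm

theorem coverNumber_le_of_refines [Finite A] [Nonempty A] {f : CantorSpace A → CantorSpace A}
    (hf : Continuous f) {𝒰 : Set (Set (CantorSpace A))} (h𝒰 : IsCover Set.univ 𝒰) {m : ℕ}
    (hm : ∀ x : CantorSpace A, ∃ U ∈ 𝒰, ∀ y : CantorSpace A, (∀ l < m, y l = x l) → y ∈ U)
    (n : ℕ) : coverNumber Set.univ f 𝒰 n ≤ itinCount f m n := by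
  obtain ⟨𝒱, h1, h2, h3, h4⟩ := exists_subcover_of_refines hf h𝒰 hm n
  refine le_trans (Nat.sInf_le ?_) h4
  exact ⟨𝒱, h1, h2, h3, rfl⟩

theorem cylinders_refines (m : ℕ) (x : CantorSpace A) :
    ∃ U ∈ cylinders A m, ∀ y : CantorSpace A, (∀ l < m, y l = x l) → y ∈ U :=
  ⟨{y | ∀ p : Fin m, y p = x p}, ⟨fun p => x p, rfl⟩, fun _ hy p => hy p p.2⟩

theorem coverNumber_cylinders [Finite A] [Nonempty A] {f : CantorSpace A → CantorSpace A}
    (hf : Continuous f) (m n : ℕ) :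
    coverNumber Set.univ f (cylinders A m) n = itinCount f m n := by
  refine le_antisymm
    (coverNumber_le_of_refines hf (isCover_cylinders m) (cylinders_refines m) n) ?_
  obtain ⟨𝒱, h1, h2, h3, -⟩ :=
    exists_subcover_of_refines hf (isCover_cylinders m) (cylinders_refines m) n
  obtain ⟨𝒲, g1, g2, g3, g4⟩ := Nat.sInf_mem (s := {k : ℕ | ∃ 𝒱 : Set (Set (CantorSpace A)),
    𝒱 ⊆ iterJoin f (cylinders A m) n ∧ IsCover Set.univ 𝒱 ∧ 𝒱.Finite ∧ 𝒱.ncard = k})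
    ⟨_, 𝒱, h1, h2, h3, rfl⟩
  exact (itinCount_le_ncard g1 g2 g3).trans g4.le

theorem IsCover.exists_refines [Finite A] {𝒰 : Set (Set (CantorSpace A))}
    (h𝒰 : IsCover Set.univ 𝒰) :
    ∃ m : ℕ, ∀ x : CantorSpace A, ∃ U ∈ 𝒰, ∀ y : CantorSpace A, (∀ l < m, y l = x l) → y ∈ U := by
  obtain ⟨δ, hδ, h⟩ := lebesgue_number_lemma_of_metric_sUnion
    (isCompact_univ (X := CantorSpace A)) h𝒰.1 h𝒰.2
  obtain ⟨m, hm⟩ := exists_pow_lt_of_lt_one hδ (by norm_num : (1 / 2 : ℝ) < 1)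
  refine ⟨m, fun x => ?_⟩
  obtain ⟨U, hU, hx⟩ := h x (Set.mem_univ _)
  exact ⟨U, hU, fun y hy => hx (lt_of_le_of_lt (cantor_dist_le hy) hm)⟩

/-- The entropy of `f` relative to the partition into cylinders of length `m`. -/
noncomputable def cylEntropy (f : CantorSpace A → CantorSpace A) (m : ℕ) : ℝ :=
  ⨅ n : ℕ, Real.logb 2 (itinCount f m (n + 1) : ℝ) / ((n : ℝ) + 1)

theorem logb_natCast_div_nonneg (k n : ℕ) : 0 ≤ Real.logb 2 (k : ℝ) / ((n : ℝ) + 1) := by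
  refine div_nonneg ?_ (by positivity)
  rcases Nat.eq_zero_or_pos k with rfl | hk
  · simp
  · exact Real.logb_nonneg (by norm_num) (by exact_mod_cast hk)

theorem bddBelow_logb_natCast_div (N : ℕ → ℕ) :
    BddBelow (Set.range fun n : ℕ => Real.logb 2 (N n : ℝ) / ((n : ℝ) + 1)) :=
  ⟨0, by rintro _ ⟨n, rfl⟩; exact logb_natCast_div_nonneg _ _⟩

theorem cylEntropy_le (f : CantorSpace A → CantorSpace A) (m n : ℕ) :
    cylEntropy f m ≤ Real.logb 2 (itinCount f m (n + 1) : ℝ) / ((n : ℝ) + 1) :=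
  ciInf_le (bddBelow_logb_natCast_div fun n => itinCount f m (n + 1)) n

theorem topEntropy_eq_iSup [Finite A] [Nonempty A] {f : CantorSpace A → CantorSpace A}
    (hf : Continuous f) :
    topEntropy Set.univ f = ⨆ m : ℕ, (cylEntropy f m : EReal) := by
  apply le_antisymm
  · refine iSup₂_le fun 𝒰 h𝒰 => ?_
    obtain ⟨m, hm⟩ := h𝒰.2.exists_refines
    refine le_iSup_of_le m (EReal.coe_le_coe_iff.2 ?_)
    refine ciInf_mono (bddBelow_logb_natCast_div
      fun n => coverNumber Set.univ f 𝒰 (n + 1)) fun n => ?_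
    refine div_le_div_of_nonneg_right ?_ (by positivity)
    have hle := coverNumber_le_of_refines hf h𝒰.2 hm (n + 1)
    -- Monotonicity of the logarithm needs a positive argument; a zero cover number would give the
    -- default `logb 2 0 = 0`.
    rcases Nat.eq_zero_or_pos (coverNumber Set.univ f 𝒰 (n + 1)) with h0 | h0
    · rw [h0]
      simpa using Real.logb_nonneg (by norm_num : (1 : ℝ) < 2)
        (by exact_mod_cast itinCount_pos f m (n + 1))
    · exact Real.logb_le_logb_of_le (by norm_num) (by exact_mod_cast h0) (by exact_mod_cast hle)
  · refine iSup_le fun m => ?_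
    have : cylEntropy f m = coverEntropyRel Set.univ f (cylinders A m) := by
      simp only [cylEntropy, coverEntropyRel, coverNumber_cylinders hf]
    rw [this]
    exact le_iSup₂_of_le (cylinders A m) ⟨Set.finite_range _, isCover_cylinders m⟩ le_rfl

end EntropyFormula

/-! ### Primitive recursive bounded quantifiers and powers -/

section PrimrecTools

theorem primrecPred_forall_lt {α : Type*} [Primcodable α] {n : α → ℕ} {R : ℕ → α → Prop}
    (hR : PrimrecRel R) (hn : Primrec n) : PrimrecPred fun x => ∀ l < n x, R l x :=
  (hR.forall_mem_list.comp (Primrec.list_range.comp hn) Primrec.id).of_eq (by simp)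

theorem primrecPred_exists_lt {α : Type*} [Primcodable α] {n : α → ℕ} {R : ℕ → α → Prop}
    (hR : PrimrecRel R) (hn : Primrec n) : PrimrecPred fun x => ∃ l < n x, R l x :=
  (hR.exists_mem_list.comp (Primrec.list_range.comp hn) Primrec.id).of_eq (by simp)

theorem primrec_two_pow : Primrec fun k : ℕ => 2 ^ k := by
  refine (Primrec.nat_rec₁ 1 (f := fun _ y => 2 * y)
    (Primrec.nat_mul.comp (Primrec.const 2) Primrec.snd).to₂).of_eq ?_
  intro k
  induction k with
  | zero => rfl
  | succ k ih => simp only [] at ih ⊢; rw [ih]; ring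

theorem primrec_pow : Primrec₂ fun b k : ℕ => b ^ k := by
  refine (Primrec.nat_rec' (f := fun p : ℕ × ℕ => p.2) (g := fun _ => 1)
    (h := fun p q => p.1 * q.2) Primrec.snd (Primrec.const 1)
    (Primrec.nat_mul.comp (Primrec.fst.comp Primrec.fst)
      (Primrec.snd.comp Primrec.snd)).to₂).of_eq ?_
  rintro ⟨b, k⟩
  induction k with
  | zero => rfl
  | succ k ih => simp only [] at ih ⊢; rw [ih]; ring

theorem primrec_cantorPt {A : Type*} [Primcodable A] (a : A) :
    Primrec fun p : ℕ × ℕ => cantorPt A a p.1 p.2 := by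
  have hw : Primrec fun i : ℕ => (Encodable.decode (α := List A) i).getD [] :=
    Primrec.option_getD.comp Primrec.decode (Primrec.const [])
  exact (Primrec.list_getD a).comp (hw.comp Primrec.fst) Primrec.snd

end PrimrecTools

/-! ### Computable maps as monotone maps on prefixes -/

section Approximation

variable {A : Type*}

/-- `F` computes finite approximations of `f`: it maps a prefix of `x` to a prefix of `f x`,
monotonically, and with unbounded length. -/
structure IsApprox (f : CantorSpace A → CantorSpace A) (F : List A → List A) : Prop where
  eq_pre : ∀ x r, F (pre x r) = pre (f x) (F (pre x r)).length
  unbounded : ∀ x k, ∃ r, k ≤ (F (pre x r)).length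
  mono : ∀ x r s, r ≤ s → (F (pre x r)).length ≤ (F (pre x s)).length

theorem IsApprox.iterate {f : CantorSpace A → CantorSpace A} {F : List A → List A}
    (h : IsApprox f F) (k : ℕ) : IsApprox f^[k] F^[k] := by
  induction k with
  | zero => exact ⟨fun x r => by simp, fun x k => ⟨k, by simp⟩, fun x r s hrs => by simpa⟩
  | succ k ih =>
    simp only [Function.iterate_succ']
    refine ⟨fun x r => ?_, fun x m => ?_, fun x r s hrs => ?_⟩
    · simp only [Function.comp_apply]
      rw [ih.eq_pre x r]
      exact h.eq_pre _ _
    · simp only [Function.comp_apply]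
      obtain ⟨r₁, hr₁⟩ := h.unbounded (f^[k] x) m
      obtain ⟨r, hr⟩ := ih.unbounded x r₁
      refine ⟨r, hr₁.trans ?_⟩
      rw [ih.eq_pre x r]
      exact h.mono _ _ _ hr
    · simp only [Function.comp_apply]
      rw [ih.eq_pre x r, ih.eq_pre x s]
      exact h.mono _ _ _ (ih.mono x r s hrs)

/-- The points for which a prefix of length `r` suffices form an open set that increases with `r`,
so compactness yields one `r` for all points. -/
theorem IsApprox.exists_uniform [Finite A] {f : CantorSpace A → CantorSpace A}
    {F : List A → List A} (h : IsApprox f F) (m n : ℕ) :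
    ∃ r, ∀ x, ∀ k < n, m ≤ (F^[k] (pre x r)).length := by
  have hex : ∀ x, ∀ n : ℕ, ∃ r, ∀ k < n, m ≤ (F^[k] (pre x r)).length := by
    intro x n
    induction n with
    | zero => exact ⟨0, by simp⟩
    | succ n ih =>
      obtain ⟨r, hr⟩ := ih
      obtain ⟨s, hs⟩ := (h.iterate n).unbounded x m
      refine ⟨max r s, fun k hk => ?_⟩
      rcases Nat.lt_succ_iff_lt_or_eq.1 hk with hk | rfl
      · exact (hr k hk).trans ((h.iterate k).mono x _ _ (le_max_left _ _))
      · exact hs.trans ((h.iterate k).mono x _ _ (le_max_right _ _))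
  let O : ℕ → Set (CantorSpace A) := fun r => {x | ∀ k < n, m ≤ (F^[k] (pre x r)).length}
  have hO : ∀ r, IsOpen (O r) := fun r => isOpen_of_agree fun x hx => ⟨r, fun y hy k hk => by
    rw [pre_congr hy]; exact hx k hk⟩
  have hmono : Monotone O := fun r s hrs x hx k hk =>
    (hx k hk).trans ((h.iterate k).mono x _ _ hrs)
  obtain ⟨r, hr⟩ := (isCompact_univ (X := CantorSpace A)).elim_directed_cover O hO
    (fun x _ => Set.mem_iUnion.2 (hex x n)) hmono.directed_le
  exact ⟨r, fun x => hr (Set.mem_univ x)⟩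

open Encodable in
-- On input `w`, all candidate certificates with code below `w.length` are tried and the longest
-- certified output is kept. Bounding the search by the length of the input makes it primitive
-- recursive.
theorem IsComputableMap.exists_isApprox [Primcodable A] {a : A}
    {f : CantorSpace A → CantorSpace A}
    (hf : IsComputableMap (cantorComp A a) (cantorComp A a) f) :
    ∃ F : List A → List A, Primrec F ∧ IsApprox f F := by
  classical
  obtain ⟨I, hI, hfI⟩ := hf
  obtain ⟨g, hg, hgI⟩ := hI.exists_stage
  -- A certificate `(v, c, s, r₀)` for `w`: by stage `s` the ball `c` is enumerated in the preimage
  -- of the cylinder of `v`, and the first `r₀` letters of `w` already force membership in `c`.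
  let cert : List A × (List A × (ℕ × ℕ × ℕ) × ℕ × ℕ) → Prop := fun p =>
    g (((encode p.2.1, 1, 2 ^ p.2.1.length - 1), p.2.2.1), p.2.2.2.1) ∧
      p.2.2.2.2 ≤ p.1.length ∧
      (∀ l < p.2.2.2.2, cantorPt A a p.2.2.1.1 l = p.1.getD l a) ∧
      p.2.2.1.2.2 + 1 < (p.2.2.1.2.1 + 1) * 2 ^ p.2.2.2.2
  have hcert : PrimrecPred cert := by
    have w : Primrec fun p : List A × (List A × (ℕ × ℕ × ℕ) × ℕ × ℕ) => p.1 := Primrec.fst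
    have v : Primrec fun p : List A × (List A × (ℕ × ℕ × ℕ) × ℕ × ℕ) => p.2.1 :=
      Primrec.fst.comp Primrec.snd
    have c : Primrec fun p : List A × (List A × (ℕ × ℕ × ℕ) × ℕ × ℕ) => p.2.2.1 :=
      Primrec.fst.comp (Primrec.snd.comp Primrec.snd)
    have s : Primrec fun p : List A × (List A × (ℕ × ℕ × ℕ) × ℕ × ℕ) => p.2.2.2.1 :=
      Primrec.fst.comp (Primrec.snd.comp (Primrec.snd.comp Primrec.snd))
    have r : Primrec fun p : List A × (List A × (ℕ × ℕ × ℕ) × ℕ × ℕ) => p.2.2.2.2 :=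
      Primrec.snd.comp (Primrec.snd.comp (Primrec.snd.comp Primrec.snd))
    refine PrimrecPred.and (hg.comp ?_) (PrimrecPred.and ?_ (PrimrecPred.and ?_ ?_))
    · exact (((Primrec.encode.comp v).pair ((Primrec.const 1).pair (Primrec.nat_sub.comp
        (primrec_two_pow.comp (Primrec.list_length.comp v)) (Primrec.const 1)))).pair c).pair s
    · exact Primrec.nat_le.comp r (Primrec.list_length.comp w)
    · have : PrimrecRel fun (l : ℕ) (p : List A × (List A × (ℕ × ℕ × ℕ) × ℕ × ℕ)) =>
          cantorPt A a p.2.2.1.1 l = p.1.getD l a :=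
        Primrec.eq.comp
          ((primrec_cantorPt a).comp ((Primrec.fst.comp (c.comp Primrec.snd)).pair Primrec.fst))
          ((Primrec.list_getD a).comp (w.comp Primrec.snd) Primrec.fst)
      exact primrecPred_forall_lt this r
    · exact Primrec.nat_lt.comp
        (Primrec.succ.comp (Primrec.snd.comp (Primrec.snd.comp c)))
        (Primrec.nat_mul.comp (Primrec.succ.comp (Primrec.fst.comp (Primrec.snd.comp c)))
          (primrec_two_pow.comp r))
  have cert_mono : ∀ x r s d, r ≤ s → cert (pre x r, d) → cert (pre x s, d) := by
    rintro x r s d hrs ⟨h1, h2, h3, h4⟩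
    simp only [length_pre] at h2
    refine ⟨h1, by simpa using h2.trans hrs, fun l hl => ?_, h4⟩
    have := h3 l hl
    simp only [] at this hl h2 ⊢
    rw [this, getD_pre _ (by omega), getD_pre _ (by omega)]
  have cert_sound : ∀ x r d, cert (pre x r, d) → d.1 = pre (f x) d.1.length := by
    rintro x r ⟨v, c, s, r₀⟩ ⟨h1, h2, h3, h4⟩
    simp only [length_pre] at h1 h2 h3 h4 ⊢
    have hx : x ∈ idealBall (cantorComp A a) c := by
      refine mem_idealBall_iff.2 ⟨r₀, fun l hl => ?_, h4⟩
      rw [h3 l hl, getD_pre _ (by omega)]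
    have hfx : x ∈ f ⁻¹' idealBall (cantorComp A a) (encode v, 1, 2 ^ v.length - 1) := by
      rw [hfI]
      exact Set.mem_biUnion ((hgI (_, c)).2 ⟨s, h1⟩) hx
    have := mem_idealBall_cylinder_iff.1 hfx
    refine List.ext_getElem (by simp) fun k hk hk' => ?_
    have hk2 := this k hk
    have e1 : (pre (f x) v.length)[k]? = some (f x k) := getElem?_pre _ hk
    have e2 : v.getD k a = v[k] := by simp [hk]
    rw [List.getElem?_eq_getElem hk', Option.some_inj] at e1
    rw [e1, hk2, cantorPt, encodek, ← e2]
    rfl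
  let step : List A → ℕ × List A → List A := fun w q =>
    Option.casesOn (decode (α := List A × (ℕ × ℕ × ℕ) × ℕ × ℕ) q.1) q.2 fun d =>
      if cert (w, d) ∧ q.2.length ≤ d.1.length then d.1 else q.2
  have hstep : Primrec₂ step := by
    refine Primrec.option_casesOn (Primrec.decode.comp (Primrec.fst.comp Primrec.snd))
      (Primrec.snd.comp Primrec.snd) ?_
    refine Primrec.ite (PrimrecPred.and (hcert.comp ?_) ?_) ?_ ?_
    · exact (Primrec.fst.comp Primrec.fst).pair Primrec.snd
    · exact Primrec.nat_le.comp
        (Primrec.list_length.comp (Primrec.snd.comp (Primrec.snd.comp Primrec.fst)))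
        (Primrec.list_length.comp (Primrec.fst.comp Primrec.snd))
    · exact Primrec.fst.comp Primrec.snd
    · exact Primrec.snd.comp (Primrec.snd.comp Primrec.fst)
  let G : List A → ℕ → List A := fun w n => Nat.rec [] (fun e acc => step w (e, acc)) n
  have hG : Primrec fun w => G w w.length :=
    Primrec.nat_rec' Primrec.list_length (Primrec.const []) hstep
  have G_succ : ∀ w n, G w (n + 1) = step w (n, G w n) := fun _ _ => rfl
  have step_none : ∀ w e acc, decode (α := List A × (ℕ × ℕ × ℕ) × ℕ × ℕ) e = none →
      step w (e, acc) = acc := fun w e acc h => by simp only [step, h]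
  have step_some : ∀ w e acc d, decode (α := List A × (ℕ × ℕ × ℕ) × ℕ × ℕ) e = some d →
      step w (e, acc) = if cert (w, d) ∧ acc.length ≤ d.1.length then d.1 else acc :=
    fun w e acc d h => by simp only [step, h]
  have le_step : ∀ w e acc, acc.length ≤ (step w (e, acc)).length := by
    intro w e acc
    rcases hd : decode (α := List A × (ℕ × ℕ × ℕ) × ℕ × ℕ) e with _ | d
    · rw [step_none _ _ _ hd]
    · rw [step_some _ _ _ _ hd]
      split_ifs with h
      · exact h.2
      · exact le_rfl
  have G_mono : ∀ w, Monotone fun n => (G w n).length := fun w =>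
    monotone_nat_of_le_succ fun n => le_step _ _ _
  refine ⟨fun w => G w w.length, hG, ⟨fun x r => ?_, fun x k => ?_, fun x r s hrs => ?_⟩⟩
  · generalize (pre x r).length = n
    induction n with
    | zero => rfl
    | succ n ih =>
      rw [G_succ]
      rcases hd : decode (α := List A × (ℕ × ℕ × ℕ) × ℕ × ℕ) n with _ | d
      · rw [step_none _ _ _ hd]
        exact ih
      · rw [step_some _ _ _ _ hd]
        split_ifs with h
        · exact cert_sound _ _ _ h.1
        · exact ih
  · have hx : x ∈ f ⁻¹' idealBall (cantorComp A a) (encode (pre (f x) k), 1, 2 ^ k - 1) :=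
      mem_idealBall_cylinder_iff.2 fun l hl => (cantorPt_encode_pre a (f x) hl).symm
    rw [hfI] at hx
    obtain ⟨c, hc, hxc⟩ := Set.mem_iUnion₂.1 hx
    obtain ⟨s, hs⟩ := (hgI (_, c)).1 hc
    obtain ⟨r₀, hr₀, hlt⟩ := mem_idealBall_iff.1 hxc
    let d : List A × (ℕ × ℕ × ℕ) × ℕ × ℕ := (pre (f x) k, c, s, r₀)
    -- The prefix must reveal `r₀` letters and be long enough for the search to reach the code of
    -- `d`.
    refine ⟨max r₀ (encode d + 1), ?_⟩
    set r := max r₀ (encode d + 1) with hr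
    have hd : cert (pre x r, d) := by
      refine ⟨?_, ?_, fun l hl => ?_, hlt⟩
      · simpa [d] using hs
      · simp [d, hr]
      · simp only [d] at hl ⊢
        rw [getD_pre _ (hl.trans_le (le_max_left _ _)), hr₀ l hl]
    have h1 : k ≤ (G (pre x r) (encode d + 1)).length := by
      rw [G_succ, step_some _ _ _ d (encodek d)]
      split_ifs with h
      · simp [d]
      · have : ¬ (G (pre x r) (encode d)).length ≤ d.1.length := fun h' => h ⟨hd, h'⟩
        simp only [d, length_pre] at this
        exact (not_le.1 this).le
    have h2 : encode d + 1 ≤ (pre x r).length := by simp [hr]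
    exact h1.trans (G_mono _ h2)
  · have key : ∀ n, (G (pre x r) n).length ≤ (G (pre x s) n).length := by
      intro n
      induction n with
      | zero => exact le_rfl
      | succ n ih =>
        rw [G_succ, G_succ]
        rcases hd : decode (α := List A × (ℕ × ℕ × ℕ) × ℕ × ℕ) n with _ | d
        · rw [step_none _ _ _ hd, step_none _ _ _ hd]
          exact ih
        · rw [step_some _ _ _ _ hd, step_some _ _ _ _ hd]
          split_ifs with h h' h'
          · exact le_rfl
          · have : ¬ (G (pre x s) n).length ≤ d.1.length :=
              fun h'' => h' ⟨cert_mono _ _ _ _ hrs h.1, h''⟩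
            exact (not_le.1 this).le
          · exact ih.trans h'.2
          · exact ih
    exact (key _).trans (G_mono _ (by simpa using hrs))

end Approximation

/-! ### Entropy of a computable map is `Σ₂`-computable -/

section UpperApproximation

variable {A : Type*}

/-- All words of length `r` over the alphabet listed by `l`. -/
def wordsOf (l : List A) (r : ℕ) : List (List A) :=
  Nat.rec [[]] (fun _ ws => ws.flatMap fun w => l.map fun b => w ++ [b]) r

theorem mem_wordsOf {l : List A} (hl : ∀ b, b ∈ l) {r : ℕ} {w : List A} :
    w ∈ wordsOf l r ↔ w.length = r := by
  induction r generalizing w with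
  | zero => simp [wordsOf]
  | succ r ih =>
    have : wordsOf l (r + 1) = (wordsOf l r).flatMap fun w => l.map fun b => w ++ [b] := rfl
    rw [this]
    simp only [List.mem_flatMap, List.mem_map, ih]
    constructor
    · rintro ⟨w', rfl, b, -, rfl⟩
      simp
    · intro h
      have hne : w ≠ [] := by rintro rfl; simp at h
      exact ⟨w.dropLast, by simp [h], w.getLast hne, hl _, List.dropLast_append_getLast hne⟩

theorem primrec_wordsOf [Primcodable A] (l : List A) : Primrec (wordsOf l) := by
  refine Primrec.nat_rec₁ [[]] ?_
  refine Primrec.list_flatMap Primrec.snd ?_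
  refine Primrec.list_map (Primrec.const l) ?_
  exact Primrec.list_append.comp (Primrec.snd.comp Primrec.fst)
    (Primrec.list_cons.comp Primrec.snd (Primrec.const []))

theorem exists_eq_pre (a : A) (w : List A) : ∃ x, w = pre x w.length := by
  refine ⟨fun k => w.getD k a, List.ext_getElem (length_pre _ _).symm fun k hk hk' => ?_⟩
  have e1 := getElem?_pre (fun k => w.getD k a : CantorSpace A) hk
  rw [List.getElem?_eq_getElem hk', Option.some_inj] at e1
  rw [e1]
  simp [hk]

/-- The list `L` contains every word of length `n` over the `m`-cylinders which is realized by an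
orbit, as witnessed by the approximations of `f` on words of length `r`. -/
def IsItinBound (l : List A) (F : List A → List A) (m n r : ℕ) (L : List (List (List A))) : Prop :=
  ∀ w ∈ wordsOf l r, (∀ k < n, m ≤ (F^[k] w).length) ∧
    (List.range n).map (fun k => (F^[k] w).take m) ∈ L

theorem primrecPred_isItinBound [Primcodable A] (l : List A) {F : List A → List A}
    (hF : Primrec F) :
    PrimrecPred fun p : ℕ × ℕ × ℕ × List (List (List A)) =>
      IsItinBound l F p.1 p.2.1 p.2.2.1 p.2.2.2 := by
  have hm : Primrec fun p : ℕ × ℕ × ℕ × List (List (List A)) => p.1 := Primrec.fst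
  have hn : Primrec fun p : ℕ × ℕ × ℕ × List (List (List A)) => p.2.1 :=
    Primrec.fst.comp Primrec.snd
  have hr : Primrec fun p : ℕ × ℕ × ℕ × List (List (List A)) => p.2.2.1 :=
    Primrec.fst.comp (Primrec.snd.comp Primrec.snd)
  have hL : Primrec fun p : ℕ × ℕ × ℕ × List (List (List A)) => p.2.2.2 :=
    Primrec.snd.comp (Primrec.snd.comp Primrec.snd)
  have hit : Primrec₂ fun (k : ℕ) (w : List A) => F^[k] w :=
    Primrec.nat_iterate Primrec.fst Primrec.snd (hF.comp Primrec.snd).to₂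
  have h1 : PrimrecRel fun (w : List A) (p : ℕ × ℕ × ℕ × List (List (List A))) =>
      ∀ k < p.2.1, p.1 ≤ (F^[k] w).length := by
    refine primrecPred_forall_lt (α := List A × ℕ × ℕ × ℕ × List (List (List A)))
      (n := fun q => q.2.2.1) (R := fun k q => q.2.1 ≤ (F^[k] q.1).length) ?_ (hn.comp Primrec.snd)
    exact Primrec.nat_le.comp (hm.comp (Primrec.snd.comp Primrec.snd))
      (Primrec.list_length.comp (hit.comp Primrec.fst (Primrec.fst.comp Primrec.snd)))
  have htup : Primrec₂ fun (w : List A) (p : ℕ × ℕ × ℕ × List (List (List A))) =>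
      (List.range p.2.1).map (fun k => (F^[k] w).take p.1) := by
    refine Primrec.list_map (Primrec.list_range.comp (hn.comp Primrec.snd)) ?_
    exact Primrec.list_take.comp (hm.comp (Primrec.snd.comp Primrec.fst))
      (hit.comp Primrec.snd (Primrec.fst.comp Primrec.fst))
  have h2 : PrimrecRel fun (w : List A) (p : ℕ × ℕ × ℕ × List (List (List A))) =>
      (List.range p.2.1).map (fun k => (F^[k] w).take p.1) ∈ p.2.2.2 := by
    have : PrimrecRel fun (L : List (List (List A))) (t : List (List A)) => t ∈ L := by
      refine (PrimrecRel.exists_mem_list (R := fun a b : List (List A) => a = b) Primrec.eq).of_eq ?_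
      intro L t
      simp
    exact this.comp (hL.comp Primrec.snd) htup
  have h12 : PrimrecRel fun (w : List A) (p : ℕ × ℕ × ℕ × List (List (List A))) =>
      (∀ k < p.2.1, p.1 ≤ (F^[k] w).length) ∧
        (List.range p.2.1).map (fun k => (F^[k] w).take p.1) ∈ p.2.2.2 := PrimrecPred.and h1 h2
  exact h12.forall_mem_list.comp
    ((primrec_wordsOf l).comp hr) Primrec.id

theorem IsItinBound.itinCount_le [Finite A] [Nonempty A] {f : CantorSpace A → CantorSpace A}
    {F : List A → List A} (hF : IsApprox f F) {l : List A} (hl : ∀ b, b ∈ l) {m n r : ℕ}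
    {L : List (List (List A))} (h : IsItinBound l F m n r L) : itinCount f m n ≤ L.length := by
  classical
  have hx : ∀ x, (List.range n).map (fun k => pre (f^[k] x) m) ∈ L := by
    intro x
    obtain ⟨h1, h2⟩ := h (pre x r) ((mem_wordsOf hl).2 (length_pre _ _))
    convert h2 using 1
    refine List.map_congr_left fun k hk => ?_
    rw [(hF.iterate k).eq_pre, take_pre _ (h1 k (List.mem_range.1 hk))]
  have := itinCount_le_of_factor (f := f) (m := m) (n := n) (γ := L.toFinset)
    (fun x => ⟨_, List.mem_toFinset.2 (hx x)⟩) ?_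
  · refine this.trans ?_
    rw [Nat.card_eq_fintype_card, Fintype.card_coe]
    exact L.toFinset_card_le
  · intro x y hxy
    rw [itin_eq_iff]
    intro k hk
    have h1 := congrArg (fun t => t[k]?) (congrArg Subtype.val hxy)
    simp only [List.getElem?_map, List.getElem?_range hk, Option.map_some, Option.some_inj] at h1
    exact pre_eq_iff.1 h1

theorem exists_isItinBound [Finite A] [Nonempty A] {f : CantorSpace A → CantorSpace A}
    {F : List A → List A} (hF : IsApprox f F) {l : List A} (hl : ∀ b, b ∈ l) (m n : ℕ) :
    ∃ r L, IsItinBound l F m n r L ∧ L.length = itinCount f m n := by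
  classical
  obtain ⟨a⟩ := ‹Nonempty A›
  obtain ⟨r, hr⟩ := hF.exists_uniform m n
  choose! g hg using fun t (ht : t ∈ Set.range (itin f m n)) => ht
  refine ⟨r, (Set.toFinite (Set.range (itin f m n))).toFinset.toList.map fun t =>
    (List.range n).map fun k => pre (f^[k] (g t)) m, fun w hw => ?_, ?_⟩
  · obtain ⟨x, hx⟩ := exists_eq_pre a w
    rw [(mem_wordsOf hl).1 hw] at hx
    subst hx
    refine ⟨hr x, List.mem_map.2 ⟨itin f m n x, by simp, List.map_congr_left fun k hk => ?_⟩⟩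
    rw [(hF.iterate k).eq_pre, take_pre _ (hr x k (List.mem_range.1 hk))]
    exact pre_congr (itin_eq_iff.1 (hg _ ⟨x, rfl⟩) k (List.mem_range.1 hk))
  · rw [List.length_map, Finset.length_toList, itinCount, Set.ncard_eq_toFinset_card]

/-- A crude computable upper bound, the default value for indices whose check fails: it cannot lower
the infimum. -/
theorem cylEntropy_le_mul [Finite A] [Nonempty A] (f : CantorSpace A → CantorSpace A) (m : ℕ) :
    cylEntropy f m ≤ m * Nat.card A := by
  have h1 : itinCount f m 1 ≤ Nat.card (Fin m → A) := by
    refine itinCount_le_of_factor (fun x p => x p) fun x y h => itin_eq_iff.2 fun k hk p hp => ?_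
    obtain rfl : k = 0 := by omega
    exact congrFun h ⟨p, hp⟩
  have h2 := cylEntropy_le f m 0
  simp only [zero_add, Nat.cast_zero, div_one] at h2
  refine h2.trans ?_
  have h0 : (0 : ℝ) < itinCount f m 1 := by exact_mod_cast itinCount_pos f m 1
  have h3 : (itinCount f m 1 : ℝ) ≤ 2 ^ (m * Nat.card A) := by
    rw [Nat.card_fun, Nat.card_eq_fintype_card (α := Fin m), Fintype.card_fin] at h1
    calc (itinCount f m 1 : ℝ) ≤ ((Nat.card A ^ m : ℕ) : ℝ) := by exact_mod_cast h1
      _ ≤ (((2 ^ Nat.card A) ^ m : ℕ) : ℝ) := by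
        exact_mod_cast Nat.pow_le_pow_left (Nat.lt_two_pow_self).le m
      _ = 2 ^ (m * Nat.card A) := by push_cast; rw [← pow_mul, mul_comm]
  calc Real.logb 2 (itinCount f m 1 : ℝ) ≤ Real.logb 2 (2 ^ (m * Nat.card A)) :=
        Real.logb_le_logb_of_le (by norm_num) h0 h3
    _ = m * Nat.card A := by
        rw [Real.logb_pow, Real.logb_self_eq_one (by norm_num)]; push_cast; ring

open Encodable in
theorem isSigmaTwo_of_topEntropy_eq [Finite A] [Primcodable A] {a : A}
    {f : CantorSpace A → CantorSpace A} (hfc : Continuous f)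
    (hf : IsComputableMap (cantorComp A a) (cantorComp A a) f) {h : ℝ}
    (hh : topEntropy Set.univ f = (h : EReal)) : IsSigmaTwo h := by
  classical
  have : Nonempty A := ⟨a⟩
  obtain ⟨F, hFp, hF⟩ := hf.exists_isApprox
  have := Fintype.ofFinite A
  let l : List A := Finset.univ.toList
  have hl : ∀ b, b ∈ l := fun b => by simp [l]
  let D : Type _ := ℕ × ℕ × List (List (List A)) × ℕ × ℕ
  let dec : ℕ → D := fun j => ((decode j : Option D)).getD (0, 0, [], 0, 0)
  have hdec : Primrec dec := Primrec.option_getD.comp Primrec.decode (Primrec.const _)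
  let P : ℕ × D → Prop := fun p => IsItinBound l F p.1 (p.2.1 + 1) p.2.2.1 p.2.2.2.1 ∧
    p.2.2.2.1.length ^ (p.2.2.2.2.1 + 1) ≤ 2 ^ p.2.2.2.2.2
  have d1 : Primrec fun p : ℕ × D => p.2.1 := Primrec.fst.comp Primrec.snd
  have d2 : Primrec fun p : ℕ × D => p.2.2.1 := Primrec.fst.comp (Primrec.snd.comp Primrec.snd)
  have d3 : Primrec fun p : ℕ × D => p.2.2.2.1 :=
    Primrec.fst.comp (Primrec.snd.comp (Primrec.snd.comp Primrec.snd))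
  have d4 : Primrec fun p : ℕ × D => p.2.2.2.2.1 :=
    Primrec.fst.comp (Primrec.snd.comp (Primrec.snd.comp (Primrec.snd.comp Primrec.snd)))
  have d5 : Primrec fun p : ℕ × D => p.2.2.2.2.2 :=
    Primrec.snd.comp (Primrec.snd.comp (Primrec.snd.comp (Primrec.snd.comp Primrec.snd)))
  have hP : PrimrecPred P := by
    refine PrimrecPred.and ((primrecPred_isItinBound l hFp).comp (Primrec.fst.pair
      ((Primrec.succ.comp d1).pair (d2.pair d3)))) (Primrec.nat_le.comp ?_ ?_)
    · exact primrec_pow.comp (Primrec.list_length.comp d3) (Primrec.succ.comp d4)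
    · exact primrec_two_pow.comp d5
  -- For data `(n, r, L, t, p)` that pass the check, `N^(t+1) ≤ 2^p` gives `log₂ N ≤ p / (t+1)`,
  -- with `N` the number of itineraries of length `n + 1`. The `- 1` offsets the `+ 1` in the
  -- denominator of `ratOfCode`.
  let c : ℕ × D → ℕ × ℕ × ℕ := fun p =>
    if P p then (p.2.2.2.2.2, 0, (p.2.1 + 1) * (p.2.2.2.2.1 + 1) - 1)
    else (p.1 * Nat.card A, 0, 0)
  have hc : Primrec c := by
    refine Primrec.ite hP (d5.pair ((Primrec.const 0).pair (Primrec.nat_sub.comp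
      (Primrec.nat_mul.comp (Primrec.succ.comp d1) (Primrec.succ.comp d4)) (Primrec.const 1)))) ?_
    exact (Primrec.nat_mul.comp Primrec.fst (Primrec.const _)).pair (Primrec.const (0, 0))
  have hc1 : ∀ p, P p → ((ratOfCode (c p) : ℚ) : ℝ) =
      (p.2.2.2.2.2 : ℝ) / (((p.2.1 : ℝ) + 1) * ((p.2.2.2.2.1 : ℝ) + 1)) := by
    intro p hp
    have h1 : 1 ≤ (p.2.1 + 1) * (p.2.2.2.2.1 + 1) := Nat.mul_pos (by omega) (by omega)
    simp [c, hp, ratOfCode, Nat.cast_sub h1]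
  have hc2 : ∀ p, ¬ P p → ((ratOfCode (c p) : ℚ) : ℝ) = p.1 * Nat.card A := by
    intro p hp
    simp [c, hp, ratOfCode]
  refine ⟨fun p => ratOfCode (c (p.1, dec p.2)), ⟨fun p => c (p.1, dec p.2),
    (hc.comp (Primrec.fst.pair (hdec.comp Primrec.snd))).to_comp, fun _ => rfl⟩, ?_⟩
  rw [← hh, topEntropy_eq_iSup hfc]
  refine iSup_congr fun m => le_antisymm (le_iInf fun j => ?_) ?_
  · rw [EReal.coe_le_coe_iff]
    simp only []
    generalize dec j = d
    by_cases hp : P (m, d)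
    · rw [hc1 _ hp]
      obtain ⟨n, r, L, t, p⟩ := d
      obtain ⟨hb, hpow⟩ := hp
      simp only at hb hpow ⊢
      refine (cylEntropy_le f m n).trans ?_
      rw [← div_div, div_right_comm]
      refine div_le_div_of_nonneg_right ?_ (by positivity)
      rw [le_div_iff₀ (by positivity)]
      have h0 : (0 : ℝ) < itinCount f m (n + 1) := by exact_mod_cast itinCount_pos f m (n + 1)
      have h1 : (itinCount f m (n + 1) : ℝ) ^ (t + 1) ≤ 2 ^ p := by
        exact_mod_cast (Nat.pow_le_pow_left (hb.itinCount_le hF hl) (t + 1)).trans hpow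
      have h2 := Real.logb_le_logb_of_le (by norm_num : (1 : ℝ) < 2) (by positivity) h1
      rw [Real.logb_pow, Real.logb_pow, Real.logb_self_eq_one (by norm_num)] at h2
      push_cast at h2
      linarith
    · rw [hc2 _ hp]
      exact cylEntropy_le_mul f m
  · refine le_of_forall_gt fun y hy => ?_
    obtain ⟨z, hz, hzy⟩ := EReal.lt_iff_exists_real_btwn.1 hy
    refine lt_of_le_of_lt ?_ hzy
    rw [EReal.coe_lt_coe_iff] at hz
    obtain ⟨n, hn⟩ := exists_lt_of_ciInf_lt hz
    obtain ⟨r, L, hb, hL⟩ := exists_isItinBound hF hl m (n + 1)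
    set N := itinCount f m (n + 1) with hN
    have hN0 : 0 < N := itinCount_pos f m (n + 1)
    rw [div_lt_iff₀ (by positivity)] at hn
    -- Rounding `(t+1) log₂ N` up to the integer `p` costs at most `1 / (t+1)` in the bound of `log₂
    -- N`, which fits in the gap left by `z`.
    obtain ⟨t, ht⟩ := exists_nat_one_div_lt (sub_pos.2 hn)
    let p : ℕ := Nat.clog 2 (N ^ (t + 1))
    have hpow : N ^ (t + 1) ≤ 2 ^ p := Nat.le_pow_clog (by norm_num) _
    have hp : (p : ℝ) ≤ (t + 1) * Real.logb 2 N + 1 := by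
      have h1 : p = ⌈Real.logb 2 ((N ^ (t + 1) : ℕ) : ℝ)⌉₊ :=
        (Real.natCeil_logb_natCast 2 _).symm
      rw [h1]
      refine (Nat.ceil_lt_add_one (Real.logb_nonneg (by norm_num) ?_)).le.trans ?_
      · exact_mod_cast Nat.one_le_pow _ _ hN0
      · rw [Nat.cast_pow, Real.logb_pow]
        push_cast
        exact le_rfl
    refine iInf_le_of_le (encode ((n, r, L, t, p) : D)) ?_
    have hd : dec (encode ((n, r, L, t, p) : D)) = (n, r, L, t, p) := by
      simp only [dec, encodek, Option.getD_some]
    rw [EReal.coe_le_coe_iff]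
    simp only [hd]
    rw [hc1 (m, (n, r, L, t, p)) ⟨hb, by simpa only [hL] using hpow⟩]
    rw [div_le_iff₀ (by positivity)]
    rw [div_lt_iff₀ (by positivity)] at ht
    nlinarith

end UpperApproximation

/-! ### Bit reversal -/

section BitReversal

/-- The reversal of the `j` lowest binary digits of `r`. -/
def bitRev (j r : ℕ) : ℕ := Nat.rec 0 (fun j v => 2 * v + r / 2 ^ j % 2) j

theorem bitRev_succ (j r : ℕ) : bitRev (j + 1) r = 2 * bitRev j r + r / 2 ^ j % 2 := rfl

theorem bitRev_lt (j r : ℕ) : bitRev j r < 2 ^ j := by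
  induction j with
  | zero => simp [bitRev]
  | succ j ih => rw [bitRev_succ, pow_succ]; omega

theorem bitRev_eq_iff {j r s : ℕ} : bitRev j r = bitRev j s ↔ r ≡ s [MOD 2 ^ j] := by
  induction j with
  | zero => simp [bitRev, Nat.modEq_one]
  | succ j ih =>
    rw [bitRev_succ, bitRev_succ, Nat.ModEq, pow_succ, Nat.mod_mul, Nat.mod_mul (x := s)]
    have h1 := Nat.mod_lt r (Nat.two_pow_pos j)
    have h2 := Nat.mod_lt s (Nat.two_pow_pos j)
    constructor
    · intro h
      have h3 : r / 2 ^ j % 2 = s / 2 ^ j % 2 := by omega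
      have h4 : bitRev j r = bitRev j s := by omega
      rw [h3, ih.1 h4]
    · intro h
      have h5 := congrArg (· % 2 ^ j) h
      simp only [Nat.add_mul_mod_self_left, Nat.mod_mod] at h5
      rw [h5] at h
      have h6 := Nat.eq_of_mul_eq_mul_left (Nat.two_pow_pos j) (Nat.add_left_cancel h)
      rw [h6, ih.2 h5]

theorem image_bitRev (j r : ℕ) :
    (Finset.range (2 ^ j)).image (fun k => bitRev j (r + k)) = Finset.range (2 ^ j) := by
  refine Finset.eq_of_subset_of_card_le ?_ ?_
  · intro v hv
    obtain ⟨k, -, rfl⟩ := Finset.mem_image.1 hv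
    exact Finset.mem_range.2 (bitRev_lt _ _)
  · rw [Finset.card_image_of_injOn]
    intro k hk l hl h
    have := Nat.ModEq.add_left_cancel' r (bitRev_eq_iff.1 h)
    exact this.eq_of_lt_of_lt (by simpa using hk) (by simpa using hl)

end BitReversal

/-! ### Counting in windows of consecutive integers -/

section Counting

variable {P : ℕ → Prop} [DecidablePred P]

/-- Bit reversal permutes the residues modulo `2^j`, so every window of length `2^j` meets each
value exactly once. -/
theorem count_bitRev (j r : ℕ) : Nat.count (fun k => P (bitRev j (r + k))) (2 ^ j) =
    Nat.count P (2 ^ j) := by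
  rw [Nat.count_eq_card_filter_range, Nat.count_eq_card_filter_range]
  conv_rhs => rw [← image_bitRev j r]
  rw [Finset.filter_image, Finset.card_image_of_injOn]
  intro k hk l hl h
  have hk' := Finset.mem_range.1 (Finset.mem_filter.1 hk).1
  have hl' := Finset.mem_range.1 (Finset.mem_filter.1 hl).1
  exact (Nat.ModEq.add_left_cancel' r (bitRev_eq_iff.1 h)).eq_of_lt_of_lt hk' hl'

theorem count_shift_mul_eq {L c : ℕ} (h : ∀ r, Nat.count (fun k => P (r + k)) L = c) (r N : ℕ) :
    Nat.count (fun k => P (r + k)) (N * L) = N * c := by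
  induction N generalizing r with
  | zero => simp
  | succ N ih =>
    rw [add_mul, one_mul, add_comm, Nat.count_add, h]
    simp only [← add_assoc, ih]
    ring

theorem mul_count_shift_mul_le {L a M : ℕ} (h : ∀ r, a * Nat.count (fun k => P (r + k)) L ≤ M)
    (r N : ℕ) : a * Nat.count (fun k => P (r + k)) (N * L) ≤ N * M := by
  induction N generalizing r with
  | zero => simp
  | succ N ih =>
    rw [add_mul, one_mul, add_comm, Nat.count_add, mul_add]
    simp only [← add_assoc]
    have h1 := h r
    have h2 := ih (r + L)
    linarith

theorem count_shift_le {L c : ℕ} (hL : 0 < L)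
    (h : ∀ r, Nat.count (fun k => P (r + k)) L = c) (r n : ℕ) :
    Nat.count (fun k => P (r + k)) n ≤ (n / L + 1) * c := by
  rw [← count_shift_mul_eq h r]
  refine Nat.count_monotone _ ?_
  rw [add_mul, one_mul]
  exact (Nat.lt_div_mul_add hL).le

/-- Averaging: `L` windows of length `n` cover the same range as `n` windows of length `L`, whose
total count is `n * c`, so some window of length `n` reaches the mean. -/
theorem exists_le_count_shift {L c : ℕ} (hL : 0 < L)
    (h : ∀ r, Nat.count (fun k => P (r + k)) L = c) (n : ℕ) :
    ∃ r, n * c ≤ L * Nat.count (fun k => P (r + k)) n := by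
  by_contra! hc
  have h1 := mul_count_shift_mul_le (P := P) (L := n) (a := L) (M := n * c - 1)
    (fun r => Nat.le_sub_one_of_lt (hc r)) 0 L
  rw [mul_comm L n, count_shift_mul_eq h] at h1
  have h2 := Nat.le_of_mul_le_mul_left h1 hL
  have h3 := hc 0
  omega

end Counting

/-! ### The gated shift and its iterates -/

section GatedShift

variable {B : Type*}

/-- The number whose lowest `j` binary digits are written on the second layer of `x`. -/
def clock (x : CantorSpace (Bool × Bool × B)) (j : ℕ) : ℕ :=
  Nat.rec 0 (fun j s => s + (x j).2.1.toNat * 2 ^ j) j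

theorem clock_succ (x : CantorSpace (Bool × Bool × B)) (j : ℕ) :
    clock x (j + 1) = clock x j + (x j).2.1.toNat * 2 ^ j := rfl

theorem clock_lt (x : CantorSpace (Bool × Bool × B)) (j : ℕ) : clock x j < 2 ^ j := by
  induction j with
  | zero => simp [clock]
  | succ j ih =>
    rw [clock_succ, pow_succ]
    have := Nat.mul_le_mul_right (2 ^ j) (Bool.toNat_le (x j).2.1)
    omega

theorem clock_modEq (x : CantorSpace (Bool × Bool × B)) {j k : ℕ} (h : j ≤ k) :
    clock x k ≡ clock x j [MOD 2 ^ j] := by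
  induction k, h using Nat.le_induction with
  | base => rfl
  | succ k hk ih =>
    rw [clock_succ]
    have h1 : (x k).2.1.toNat * 2 ^ k ≡ 0 [MOD 2 ^ j] :=
      (Nat.modEq_zero_iff_dvd).2 (Dvd.dvd.mul_left (pow_dvd_pow 2 hk) _)
    exact (ih.add h1)

theorem clock_congr {x y : CantorSpace (Bool × Bool × B)} {j : ℕ}
    (h : ∀ l < j, (x l).2.1 = (y l).2.1) : clock x j = clock y j := by
  induction j with
  | zero => rfl
  | succ j ih =>
    rw [clock_succ, clock_succ, ih fun l hl => h l (by omega), h j (by omega)]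

/-- The `p`-th binary digit of `n`. -/
def digit (n p : ℕ) : Bool := decide (n / 2 ^ p % 2 = 1)

theorem digit_congr {m n p : ℕ} (h : m ≡ n [MOD 2 ^ (p + 1)]) : digit m p = digit n p := by
  have : m / 2 ^ p % 2 = n / 2 ^ p % 2 := by
    rw [← Nat.mod_mul_right_div_self, ← Nat.mod_mul_right_div_self n, ← pow_succ, h]
  rw [digit, digit, this]

theorem clock_eq_mod {x : CantorSpace (Bool × Bool × B)} {n j : ℕ}
    (h : ∀ l < j, (x l).2.1 = digit n l) : clock x j = n % 2 ^ j := by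
  induction j with
  | zero => simp [clock, Nat.mod_one]
  | succ j ih =>
    rw [clock_succ, ih fun l hl => h l (by omega), h j (by omega), pow_succ, Nat.mod_mul]
    congr 1
    rw [mul_comm, digit]
    rcases Nat.mod_two_eq_zero_or_one (n / 2 ^ j) with h | h <;> simp [h]

/-- The first layer of `x` begins with exactly `i` letters `true`. -/
def HasIndex (x : CantorSpace (Bool × Bool × B)) (i : ℕ) : Prop :=
  (x i).1 = false ∧ ∀ l < i, (x l).1 = true

theorem HasIndex.unique {x : CantorSpace (Bool × Bool × B)} {i j : ℕ} (hi : HasIndex x i)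
    (hj : HasIndex x j) : i = j := by
  rcases lt_trichotomy i j with h | h | h
  · have := hj.2 i h
    rw [hi.1] at this
    simp at this
  · exact h
  · have := hi.2 j h
    rw [hj.1] at this
    simp at this

theorem HasIndex.congr {x y : CantorSpace (Bool × Bool × B)} {i : ℕ} (hi : HasIndex x i)
    (h : ∀ l ≤ i, (y l).1 = (x l).1) : HasIndex y i :=
  ⟨(h i le_rfl).trans hi.1, fun l hl => (h l hl.le).trans (hi.2 l hl)⟩

/-- The letter in column `k` of `x`, a point of index `i`, is not erased. -/
def IsOpenColumn (G : ℕ → ℕ → ℕ → Prop) (x : CantorSpace (Bool × Bool × B)) (i k : ℕ) : Prop :=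
  HasIndex x i ∧ G i k (bitRev k (clock x k + k))

open Classical in
/-- The first layer is fixed, the second one is an odometer, and the third one is shifted, the
letters which leave a closed column, or a column of number at most the index, being erased. -/
noncomputable def gatedShift (G : ℕ → ℕ → ℕ → Prop) (b₀ : B)
    (x : CantorSpace (Bool × Bool × B)) : CantorSpace (Bool × Bool × B) := fun p =>
  ((x p).1, digit (clock x (p + 1) + 1) p,
    if ∃ i < p + 1, IsOpenColumn G x i (p + 1) then (x (p + 1)).2.2 else b₀)

variable {G : ℕ → ℕ → ℕ → Prop} {b₀ : B}

open Classical in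
theorem gatedShift_snd_snd (x : CantorSpace (Bool × Bool × B)) (p : ℕ) :
    (gatedShift G b₀ x p).2.2 =
      if ∃ i < p + 1, IsOpenColumn G x i (p + 1) then (x (p + 1)).2.2 else b₀ := rfl

theorem IsOpenColumn.congr {x y : CantorSpace (Bool × Bool × B)} {i k : ℕ} (hik : i < k)
    (hx : IsOpenColumn G x i k) (h : ∀ l < k, y l = x l) : IsOpenColumn G y i k := by
  refine ⟨hx.1.congr fun l hl => by rw [h l (by omega)], ?_⟩
  rw [clock_congr fun l hl => by rw [h l hl]]
  exact hx.2

theorem gatedShift_congr {x y : CantorSpace (Bool × Bool × B)} {p : ℕ}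
    (h : ∀ l < p + 2, y l = x l) : gatedShift G b₀ y p = gatedShift G b₀ x p := by
  classical
  have h1 : ∀ l < p + 1, y l = x l := fun l hl => h l (by omega)
  have h2 : (∃ i < p + 1, IsOpenColumn G y i (p + 1)) ↔ ∃ i < p + 1, IsOpenColumn G x i (p + 1) :=
    exists_congr fun i => and_congr_right fun hi =>
      ⟨fun hy => hy.congr hi fun l hl => (h1 l hl).symm, fun hx => hx.congr hi h1⟩
  have h3 : clock y (p + 1) = clock x (p + 1) := clock_congr fun l hl => by rw [h1 l hl]
  simp only [gatedShift, h3, h p (by omega), h (p + 1) (by omega)]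
  exact congrArg _ (congrArg _ (if_congr h2 rfl rfl))

theorem iterate_gatedShift_fst (x : CantorSpace (Bool × Bool × B)) (n p : ℕ) :
    ((gatedShift G b₀)^[n] x p).1 = (x p).1 := by
  induction n with
  | zero => rfl
  | succ n ih => rw [Function.iterate_succ_apply']; exact ih

theorem clock_gatedShift (x : CantorSpace (Bool × Bool × B)) (j : ℕ) :
    clock (gatedShift G b₀ x) j = (clock x j + 1) % 2 ^ j :=
  clock_eq_mod fun _ hl => digit_congr ((clock_modEq x hl).symm.add_right 1)

theorem clock_iterate_gatedShift (x : CantorSpace (Bool × Bool × B)) (n j : ℕ) :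
    clock ((gatedShift G b₀)^[n] x) j = (clock x j + n) % 2 ^ j := by
  induction n with
  | zero => exact (Nat.mod_eq_of_lt (clock_lt x j)).symm
  | succ n ih =>
    rw [Function.iterate_succ_apply', clock_gatedShift, ih, Nat.mod_add_mod, add_assoc]

theorem iterate_gatedShift_snd_fst (x : CantorSpace (Bool × Bool × B)) (n p : ℕ) :
    ((gatedShift G b₀)^[n + 1] x p).2.1 = digit (clock x (p + 1) + (n + 1)) p := by
  rw [Function.iterate_succ_apply']
  refine digit_congr ?_
  rw [clock_iterate_gatedShift, ← add_assoc]
  exact (Nat.mod_modEq _ _).add_right 1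

theorem hasIndex_iterate_gatedShift {x : CantorSpace (Bool × Bool × B)} {n i : ℕ} :
    HasIndex ((gatedShift G b₀)^[n] x) i ↔ HasIndex x i := by
  simp only [HasIndex, iterate_gatedShift_fst]

/-- Deleting the last binary digit of `bitRev (j + 1) r` leaves `bitRev j r`, so the hypothesis on
`G` applies once per level. -/
theorem bitRev_gate_antitone (hG : ∀ i j v, ∀ e < 2, G i (j + 1) (2 * v + e) → G i j v)
    {i j k r : ℕ} (hjk : j ≤ k) (h : G i k (bitRev k r)) : G i j (bitRev j r) := by
  induction k, hjk using Nat.le_induction with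
  | base => exact h
  | succ k _ ih => exact ih (hG _ _ _ _ (Nat.mod_lt _ two_pos) h)

open Classical in
-- The letter seen in column `p` started in column `p + n + 1` and crossed every gate in between.
-- Clock plus column is constant modulo the relevant powers of two along its path, so by
-- monotonicity the first gate implies all later ones.
theorem iterate_gatedShift_snd_snd (hG : ∀ i j v, ∀ e < 2, G i (j + 1) (2 * v + e) → G i j v)
    (x : CantorSpace (Bool × Bool × B)) (n p : ℕ) :
    ((gatedShift G b₀)^[n + 1] x p).2.2 =
      if ∃ i < p + 1, IsOpenColumn G x i (p + (n + 1)) then (x (p + (n + 1))).2.2 else b₀ := by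
  induction n generalizing p with
  | zero => rfl
  | succ n ih =>
    rw [Function.iterate_succ_apply']
    -- The last crossing adds only the constraint `i < p + 1` to the earlier ones: its gate is
    -- implied by the first gate.
    have h1 : ((∃ i < p + 1, IsOpenColumn G ((gatedShift G b₀)^[n + 1] x) i (p + 1)) ∧
        ∃ i < p + 1 + 1, IsOpenColumn G x i (p + 1 + (n + 1))) ↔
        ∃ i < p + 1, IsOpenColumn G x i (p + (n + 1 + 1)) := by
      have e : p + 1 + (n + 1) = p + (n + 1 + 1) := by ring
      rw [e]
      constructor
      · rintro ⟨⟨i, hi, hx, -⟩, ⟨i', -, hx', h⟩⟩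
        obtain rfl := (hasIndex_iterate_gatedShift.1 hx).unique hx'
        exact ⟨i, hi, hx', h⟩
      · rintro ⟨i, hi, hx, h⟩
        refine ⟨⟨i, hi, hasIndex_iterate_gatedShift.2 hx, ?_⟩, i, by omega, hx, h⟩
        have h2 := bitRev_gate_antitone hG (show p + 1 ≤ p + (n + 1 + 1) by omega) h
        convert h2 using 1
        rw [bitRev_eq_iff, clock_iterate_gatedShift]
        have h3 := ((Nat.mod_modEq (clock x (p + 1) + (n + 1)) (2 ^ (p + 1))).add_right (p + 1))
        refine h3.trans ?_
        have h4 := (clock_modEq x (show p + 1 ≤ p + (n + 1 + 1) by omega)).symm.add_right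
          (p + (n + 1 + 1))
        convert h4 using 1
        ring
    rw [gatedShift_snd_snd, ih (p + 1)]
    by_cases h : ∃ i < p + 1, IsOpenColumn G x i (p + (n + 1 + 1))
    · rw [if_pos h, if_pos (h1.2 h).1, if_pos (h1.2 h).2]
      congr 3
      ring
    · rw [if_neg h]
      rw [← h1, not_and_or] at h
      rcases h with h | h
      · rw [if_neg h]
      · rw [if_neg h, ite_self]

end GatedShift

/-! ### Continuity and computability of local maps -/

section LocalMaps

variable {A : Type*}

theorem continuous_of_local {f : CantorSpace A → CantorSpace A}
    (hloc : ∀ (x y : CantorSpace A) (p : ℕ), (∀ l < p + 2, y l = x l) → f y p = f x p) :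
    Continuous f :=
  continuous_of_agree fun k => ⟨k + 1, fun x y h p hp => hloc x y p fun l hl => h l (by omega)⟩

/-- The first `k` letters of the image are constant on each cylinder of length `k + 1`, so
evaluating `f` at the centre decides whether that cylinder maps into the target ball. -/
theorem isComputableMap_of_local [Primcodable A] {a : A} {f : CantorSpace A → CantorSpace A}
    (hloc : ∀ (x y : CantorSpace A) (p : ℕ), (∀ l < p + 2, y l = x l) → f y p = f x p)
    (hf : Primrec fun q : ℕ × ℕ => f (cantorPt A a q.1) q.2) :
    IsComputableMap (cantorComp A a) (cantorComp A a) f := by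
  classical
  let R : ℕ → (ℕ × ℕ × ℕ) × (ℕ × ℕ × ℕ) → Prop := fun k p =>
    p.2.2.2 + 1 = 2 ^ (k + 1) ∧ (∀ l < k, f (cantorPt A a p.2.1) l = cantorPt A a p.1.1 l) ∧
      p.1.2.2 + 1 < (p.1.2.1 + 1) * 2 ^ k
  have hR : PrimrecRel R := by
    have hk : Primrec fun q : ℕ × (ℕ × ℕ × ℕ) × (ℕ × ℕ × ℕ) => q.1 := Primrec.fst
    have hm : Primrec fun q : ℕ × (ℕ × ℕ × ℕ) × (ℕ × ℕ × ℕ) => q.2.1 :=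
      Primrec.fst.comp Primrec.snd
    have hc : Primrec fun q : ℕ × (ℕ × ℕ × ℕ) × (ℕ × ℕ × ℕ) => q.2.2 :=
      Primrec.snd.comp Primrec.snd
    have h1 : PrimrecPred fun q : ℕ × (ℕ × ℕ × ℕ) × (ℕ × ℕ × ℕ) =>
        q.2.2.2.2 + 1 = 2 ^ (q.1 + 1) := by
      have e1 : Primrec fun q : ℕ × (ℕ × ℕ × ℕ) × (ℕ × ℕ × ℕ) => q.2.2.2.2 + 1 :=
        Primrec.succ.comp (Primrec.snd.comp (Primrec.snd.comp hc))
      have e2 : Primrec fun q : ℕ × (ℕ × ℕ × ℕ) × (ℕ × ℕ × ℕ) => 2 ^ (q.1 + 1) :=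
        primrec_two_pow.comp (Primrec.succ.comp hk)
      exact Primrec.eq.comp e1 e2
    have h2 : PrimrecPred fun q : ℕ × (ℕ × ℕ × ℕ) × (ℕ × ℕ × ℕ) =>
        ∀ l < q.1, f (cantorPt A a q.2.2.1) l = cantorPt A a q.2.1.1 l := by
      have e1 : Primrec fun q : ℕ × ℕ × (ℕ × ℕ × ℕ) × (ℕ × ℕ × ℕ) => (q.2.2.2.1, q.1) :=
        (Primrec.fst.comp (hc.comp Primrec.snd)).pair Primrec.fst
      have e2 : Primrec fun q : ℕ × ℕ × (ℕ × ℕ × ℕ) × (ℕ × ℕ × ℕ) => (q.2.2.1.1, q.1) :=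
        (Primrec.fst.comp (hm.comp Primrec.snd)).pair Primrec.fst
      have e4 : Primrec fun q : ℕ × ℕ × (ℕ × ℕ × ℕ) × (ℕ × ℕ × ℕ) =>
          f (cantorPt A a q.2.2.2.1) q.1 := (hf.comp e1 :)
      have e5 : Primrec fun q : ℕ × ℕ × (ℕ × ℕ × ℕ) × (ℕ × ℕ × ℕ) =>
          cantorPt A a q.2.2.1.1 q.1 :=
        ((primrec_cantorPt a).comp e2 :)
      have e3 : PrimrecRel fun (l : ℕ) (q : ℕ × (ℕ × ℕ × ℕ) × (ℕ × ℕ × ℕ)) =>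
          f (cantorPt A a q.2.2.1) l = cantorPt A a q.2.1.1 l :=
        Primrec.eq.comp e4 e5
      exact primrecPred_forall_lt e3 hk
    have h3 : PrimrecPred fun q : ℕ × (ℕ × ℕ × ℕ) × (ℕ × ℕ × ℕ) =>
        q.2.1.2.2 + 1 < (q.2.1.2.1 + 1) * 2 ^ q.1 := by
      have e1 : Primrec fun q : ℕ × (ℕ × ℕ × ℕ) × (ℕ × ℕ × ℕ) => q.2.1.2.2 + 1 :=
        Primrec.succ.comp (Primrec.snd.comp (Primrec.snd.comp hm))
      have e2 : Primrec fun q : ℕ × (ℕ × ℕ × ℕ) × (ℕ × ℕ × ℕ) => q.2.1.2.1 + 1 :=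
        Primrec.succ.comp (Primrec.fst.comp (Primrec.snd.comp hm))
      exact Primrec.nat_lt.comp e1 (Primrec.nat_mul.comp e2 (primrec_two_pow.comp hk))
    exact PrimrecPred.and h1 (PrimrecPred.and h2 h3)
  have hball : ∀ (x : CantorSpace A) (c : ℕ × ℕ × ℕ) (k : ℕ), c.2.1 = 1 →
      c.2.2 + 1 = 2 ^ (k + 1) →
      (x ∈ idealBall (cantorComp A a) c ↔ ∀ l < k + 1, x l = cantorPt A a c.1 l) := by
    rintro x ⟨i, b, d⟩ k rfl hd
    obtain rfl : d = 2 ^ (k + 1) - 1 := Nat.eq_sub_of_add_eq hd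
    exact mem_idealBall_cylinder_iff
  -- The bound on `k` loses nothing, since `c.2.2 + 1 = 2^(k+1) > k`, and it keeps the search
  -- primitive recursive.
  refine ⟨fun m => {c | c.2.1 = 1 ∧ ∃ k < c.2.2 + 1, R k (m, c)}, ?_, fun m => ?_⟩
  · refine PrimrecPred.to_re (PrimrecPred.and ?_ ?_)
    · exact Primrec.eq.comp (Primrec.fst.comp (Primrec.snd.comp Primrec.snd)) (Primrec.const 1)
    · exact primrecPred_exists_lt hR
        (Primrec.succ.comp (Primrec.snd.comp (Primrec.snd.comp Primrec.snd)))
  · ext x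
    simp only [ballUnion, Set.mem_preimage, Set.mem_iUnion, Set.mem_ofPred_eq]
    rw [mem_idealBall_iff]
    constructor
    · rintro ⟨k, hk, hlt⟩
      have h1 : 2 ^ (k + 1) - 1 + 1 = 2 ^ (k + 1) := Nat.sub_add_cancel Nat.one_le_two_pow
      refine ⟨(Encodable.encode (pre x (k + 1)), 1, 2 ^ (k + 1) - 1),
        ⟨rfl, k, ?_, h1, fun l hl => ?_, hlt⟩, ?_⟩
      · simp only [h1]
        exact (Nat.lt_two_pow_self).trans (Nat.pow_lt_pow_right (by norm_num) (by omega))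
      · rw [← hk l hl]
        exact hloc _ _ _ fun p hp => cantorPt_encode_pre a x (by omega)
      · exact (hball _ _ k rfl h1).2 fun l hl => (cantorPt_encode_pre a x hl).symm
    · rintro ⟨c, ⟨hc1, k, -, hk, hag, hlt⟩, hx⟩
      rw [hball _ _ k hc1 hk] at hx
      refine ⟨k, fun l hl => ?_, hlt⟩
      rw [← hag l hl]
      exact hloc _ _ _ fun p hp => hx p (by omega)

end LocalMaps

/-! ### Computability of the gated shift -/

section GatedShiftComputable

variable {B : Type*} [Primcodable B]

theorem primrec_digit : Primrec₂ digit := by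
  have h : PrimrecPred fun q : ℕ × ℕ => q.1 / 2 ^ q.2 % 2 = 1 :=
    Primrec.eq.comp (Primrec.nat_mod.comp
      (Primrec.nat_div.comp Primrec.fst (primrec_two_pow.comp Primrec.snd)) (Primrec.const 2))
      (Primrec.const 1)
  exact h.decide

theorem primrec_bitRev : Primrec₂ bitRev := by
  refine Primrec.nat_rec' (f := fun q : ℕ × ℕ => q.1) (g := fun _ => 0)
    (h := fun q s => 2 * s.2 + q.2 / 2 ^ s.1 % 2) Primrec.fst (Primrec.const 0) ?_
  refine Primrec.nat_add.comp
    (Primrec.nat_mul.comp (Primrec.const 2) (Primrec.snd.comp Primrec.snd)) ?_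
  exact Primrec.nat_mod.comp (Primrec.nat_div.comp (Primrec.snd.comp Primrec.fst)
    (primrec_two_pow.comp (Primrec.fst.comp Primrec.snd))) (Primrec.const 2)

theorem primrec_clock_cantorPt (a : Bool × Bool × B) :
    Primrec fun q : ℕ × ℕ => clock (cantorPt _ a q.1) q.2 := by
  refine Primrec.nat_rec' (f := fun q : ℕ × ℕ => q.2) (g := fun _ => 0)
    (h := fun q s => s.2 + (cantorPt _ a q.1 s.1).2.1.toNat * 2 ^ s.1)
    Primrec.snd (Primrec.const 0) ?_
  refine Primrec.nat_add.comp (Primrec.snd.comp Primrec.snd) (Primrec.nat_mul.comp ?_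
    (primrec_two_pow.comp (Primrec.fst.comp Primrec.snd)))
  exact (Primrec.dom_finite Bool.toNat).comp (Primrec.fst.comp (Primrec.snd.comp
    ((primrec_cantorPt a).comp ((Primrec.fst.comp Primrec.fst).pair
      (Primrec.fst.comp Primrec.snd)))))

variable {G : ℕ → ℕ → ℕ → Prop}

theorem primrec_isOpenColumn_cantorPt (hG : PrimrecPred fun q : ℕ × ℕ × ℕ => G q.1 q.2.1 q.2.2)
    (a : Bool × Bool × B) :
    PrimrecPred fun q : ℕ × ℕ × ℕ => IsOpenColumn G (cantorPt _ a q.1) q.2.1 q.2.2 := by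
  have hx : Primrec fun q : ℕ × ℕ × ℕ => q.1 := Primrec.fst
  have hi : Primrec fun q : ℕ × ℕ × ℕ => q.2.1 := Primrec.fst.comp Primrec.snd
  have hk : Primrec fun q : ℕ × ℕ × ℕ => q.2.2 := Primrec.snd.comp Primrec.snd
  have hz : Primrec fun q : ℕ × ℕ => (cantorPt _ a q.1 q.2).1 :=
    Primrec.fst.comp (primrec_cantorPt a)
  refine PrimrecPred.and (PrimrecPred.and ?_ ?_) ?_
  · exact Primrec.eq.comp (hz.comp (hx.pair hi)) (Primrec.const false)
  · refine primrecPred_forall_lt (n := fun q : ℕ × ℕ × ℕ => q.2.1)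
      (R := fun l q => (cantorPt _ a q.1 l).1 = true) ?_ hi
    exact Primrec.eq.comp (hz.comp ((hx.comp Primrec.snd).pair Primrec.fst)) (Primrec.const true)
  · exact hG.comp (hi.pair (hk.pair (primrec_bitRev.comp hk
      (Primrec.nat_add.comp ((primrec_clock_cantorPt a).comp (hx.pair hk)) hk))))

theorem isComputableMap_gatedShift (hG : PrimrecPred fun q : ℕ × ℕ × ℕ => G q.1 q.2.1 q.2.2)
    (b₀ : B) (a : Bool × Bool × B) :
    IsComputableMap (cantorComp _ a) (cantorComp _ a) (gatedShift G b₀) := by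
  classical
  refine isComputableMap_of_local (fun x y p h => gatedShift_congr h) ?_
  have hp : Primrec fun q : ℕ × ℕ => q.2 + 1 := Primrec.succ.comp Primrec.snd
  have hb : Primrec fun q : ℕ × ℕ => (cantorPt _ a q.1 (q.2 + 1)).2.2 :=
    Primrec.snd.comp (Primrec.snd.comp ((primrec_cantorPt a).comp (Primrec.fst.pair hp)))
  refine (Primrec.fst.comp (primrec_cantorPt a)).pair (Primrec.pair ?_ ?_)
  · exact primrec_digit.comp (Primrec.succ.comp ((primrec_clock_cantorPt a).comp
      (Primrec.fst.pair hp))) Primrec.snd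
  · refine Primrec.ite (primrecPred_exists_lt (n := fun q : ℕ × ℕ => q.2 + 1)
      (R := fun i q => IsOpenColumn G (cantorPt _ a q.1) i (q.2 + 1)) ?_ hp) hb (Primrec.const b₀)
    exact (primrec_isOpenColumn_cantorPt hG a).comp
      ((Primrec.fst.comp Primrec.snd).pair (Primrec.fst.pair (hp.comp Primrec.snd)))

end GatedShiftComputable

/-! ### Entropy of the gated shift -/

section GatedShiftEntropy

variable {B : Type*} {G : ℕ → ℕ → ℕ → Prop} {b₀ : B}

open Classical in
-- An itinerary is determined by the first `m` letters of the frozen layer, the first `J` letters of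
-- the other two, and the letters in the columns below `n + m` that can pass a gate. At most `D`
-- columns need recording, by comparison with the gate of the fixed level `J`.
theorem itinCount_gatedShift_le [Finite B] (hG : ∀ i j v, ∀ e < 2, G i (j + 1) (2 * v + e) → G i j v)
    {m n J D : ℕ} (hmJ : m ≤ J) (hJD : J ≤ D)
    (hD : ∀ i < m, ∀ r, J + Nat.count (fun k => G i J (bitRev J (r + k))) (n + m) ≤ D) :
    itinCount (gatedShift G b₀) m n ≤
      2 ^ m * (2 ^ J * (Nat.card B ^ J * Nat.card B ^ D)) := by
  have : Nonempty B := ⟨b₀⟩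
  -- The columns to record: those below `J`, and those whose coarser level-`J` gate is open. The set
  -- depends on `x` only through coded data.
  let S : CantorSpace (Bool × Bool × B) → Finset ℕ := fun x => Finset.range J ∪
    (Finset.range (n + m)).filter
      fun k => ∃ i < m, HasIndex x i ∧ G i J (bitRev J (clock x J + k))
  have hS : ∀ x, (S x).toList.length ≤ D := by
    intro x
    rw [Finset.length_toList]
    refine (Finset.card_union_le _ _).trans ?_
    rw [Finset.card_range]
    by_cases h : ∃ i < m, HasIndex x i
    · obtain ⟨i, hi, hx⟩ := h
      refine le_trans (Nat.add_le_add_left ?_ J) (hD i hi (clock x J))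
      rw [Nat.count_eq_card_filter_range]
      refine Finset.card_le_card fun k hk => ?_
      obtain ⟨hk1, i', -, hx', hk2⟩ := Finset.mem_filter.1 hk
      obtain rfl := hx.unique hx'
      exact Finset.mem_filter.2 ⟨hk1, hk2⟩
    · have he : (Finset.range (n + m)).filter
          (fun k => ∃ i < m, HasIndex x i ∧ G i J (bitRev J (clock x J + k))) = ∅ :=
        Finset.filter_eq_empty_iff.2 fun k _ hk => by
          obtain ⟨i, hi, hx, -⟩ := hk
          exact h ⟨i, hi, hx⟩
      rw [he]
      simpa using hJD
  let w : CantorSpace (Bool × Bool × B) → ℕ → B := fun x k =>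
    if ∃ i < m, IsOpenColumn G x i k then (x k).2.2 else b₀
  let code : CantorSpace (Bool × Bool × B) →
      (Fin m → Bool) × (Fin J → Bool) × (Fin J → B) × (Fin D → B) := fun x =>
    (fun l => (x l).1, fun l => (x l).2.1, fun l => (x l).2.2,
      fun e => w x ((S x).toList.getD e 0))
  have hcard : Nat.card ((Fin m → Bool) × (Fin J → Bool) × (Fin J → B) × (Fin D → B)) =
      2 ^ m * (2 ^ J * (Nat.card B ^ J * Nat.card B ^ D)) := by
    simp [Nat.card_prod, Nat.card_fun]
  rw [← hcard]
  refine itinCount_le_of_factor code fun x y hxy => ?_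
  simp only [code, Prod.mk.injEq] at hxy
  obtain ⟨h1, h2, h3, h4⟩ := hxy
  have hz : ∀ l < m, (x l).1 = (y l).1 := fun l hl => congrFun h1 ⟨l, hl⟩
  have hc : ∀ j ≤ J, clock x j = clock y j :=
    fun j hj => clock_congr fun l hl => congrFun h2 ⟨l, by omega⟩
  have hb : ∀ l < J, (x l).2.2 = (y l).2.2 := fun l hl => congrFun h3 ⟨l, hl⟩
  have hidx : ∀ i < m, (HasIndex x i ↔ HasIndex y i) := fun i hi =>
    ⟨fun h => h.congr fun l hl => (hz l (by omega)).symm,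
      fun h => h.congr fun l hl => hz l (by omega)⟩
  have hSxy : S x = S y := by
    simp only [S, hc J le_rfl]
    congr 1
    refine Finset.filter_congr fun k _ => exists_congr fun i => and_congr_right fun hi => ?_
    rw [hidx i hi]
  have hwS : ∀ k ∈ S x, w x k = w y k := by
    intro k hk
    obtain ⟨e, he, hek⟩ := List.getElem_of_mem (Finset.mem_toList.2 hk)
    have := congrFun h4 ⟨e, he.trans_le (hS x)⟩
    simp only [← hSxy] at this
    rwa [show (S x).toList.getD e 0 = k by rw [List.getD_eq_getElem _ _ he, hek]] at this
  have hw0 : ∀ z : CantorSpace (Bool × Bool × B), ∀ k < n + m, k ∉ S z → w z k = b₀ := by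
    intro z k hk hkS
    refine if_neg ?_
    rintro ⟨i, hi, hzi, hop⟩
    simp only [S, Finset.mem_union, Finset.mem_range, Finset.mem_filter, not_or, not_and,
      not_exists, not_lt] at hkS
    obtain ⟨hJk, hcl⟩ := hkS
    refine hcl hk i hi hzi ?_
    have h5 := bitRev_gate_antitone hG hJk hop
    convert h5 using 1
    exact bitRev_eq_iff.2 ((clock_modEq z hJk).symm.add_right k)
  have hw : ∀ k < n + m, w x k = w y k := by
    intro k hk
    by_cases hkS : k ∈ S x
    · exact hwS k hkS
    · rw [hw0 x k hk hkS, hw0 y k hk (hSxy ▸ hkS)]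
  refine itin_eq_iff.2 fun k hk p hp => ?_
  rcases k with _ | k
  · exact Prod.ext (hz p hp)
      (Prod.ext (congrFun h2 ⟨p, by omega⟩) (hb p (by omega)))
  · refine Prod.ext ?_ (Prod.ext ?_ ?_)
    · rw [iterate_gatedShift_fst, iterate_gatedShift_fst, hz p hp]
    · rw [iterate_gatedShift_snd_fst, iterate_gatedShift_snd_fst, hc _ (by omega)]
    · have key : ∀ z : CantorSpace (Bool × Bool × B), ((gatedShift G b₀)^[k + 1] z p).2.2 =
          if ∃ i < p + 1, HasIndex z i then w z (p + (k + 1)) else b₀ := by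
        intro z
        rw [iterate_gatedShift_snd_snd hG]
        by_cases h : ∃ i < p + 1, HasIndex z i
        · rw [if_pos h]
          obtain ⟨i, hi, hzi⟩ := h
          refine if_congr ?_ rfl rfl
          constructor
          · rintro ⟨i', hi', ho⟩
            exact ⟨i', by omega, ho⟩
          · rintro ⟨i', -, ho⟩
            obtain rfl := hzi.unique ho.1
            exact ⟨i, hi, ho⟩
        · rw [if_neg h, if_neg]
          rintro ⟨i, hi, ho⟩
          exact h ⟨i, hi, ho.1⟩
      rw [key, key, hw _ (by omega)]
      refine if_congr ?_ rfl rfl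
      exact exists_congr fun i => and_congr_right fun hi => hidx i (by omega)

open Classical in
-- Letters placed freely in the columns `i + k` that satisfy the strongest gate, of level `i + n`,
-- reach column `i` unerased at time `k`. Column `i` is the leftmost one where index `i` lets
-- letters arrive.
theorem le_itinCount_gatedShift [Finite B]
    (hG : ∀ i j v, ∀ e < 2, G i (j + 1) (2 * v + e) → G i j v) (i n r : ℕ) :
    Nat.card B ^ Nat.count (fun k => G i (i + n) (bitRev (i + n) (r + k))) n ≤
      itinCount (gatedShift G b₀) (i + 1) n := by
  let J := i + n
  let S : Finset ℕ := (Finset.range n).filter fun k => G i J (bitRev J (r + k))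
  -- Chosen so that `ρ + i ≡ r` modulo `2^J`: column `i + k` then has clock plus column congruent to
  -- `r + k`.
  let ρ : ℕ := r + i * (2 ^ J - 1)
  let c : (S → B) → CantorSpace (Bool × Bool × B) := fun s l =>
    (decide (l < i), digit ρ l, if h : i ≤ l ∧ l - i ∈ S then s ⟨l - i, h.2⟩ else b₀)
  have hcard : Nat.card (S → B) =
      Nat.card B ^ Nat.count (fun k => G i (i + n) (bitRev (i + n) (r + k))) n := by
    rw [Nat.card_fun, Nat.card_eq_fintype_card (α := S), Fintype.card_coe,
      Nat.count_eq_card_filter_range]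
  rw [← hcard]
  refine le_itinCount_of_injective c fun s t hst => ?_
  rw [itin_eq_iff] at hst
  have hidx : ∀ s, HasIndex (c s) i := fun s =>
    ⟨by simp [c], fun l hl => by simp [c, hl]⟩
  have hread : ∀ s (k : S), ((gatedShift G b₀)^[(k : ℕ)] (c s) i).2.2 = s k := by
    rintro s ⟨k, hk⟩
    have hk' := Finset.mem_filter.1 hk
    have hkn := Finset.mem_range.1 hk'.1
    have hck : (c s (i + k)).2.2 = s ⟨k, hk⟩ := by
      simp only [c]
      rw [dif_pos ⟨Nat.le_add_right _ _, by simpa using hk⟩]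
      simp
    -- At time zero the letter is read in place and crosses no gate.
    rcases k with _ | k
    · exact hck
    · rw [iterate_gatedShift_snd_snd hG, if_pos, hck]
      refine ⟨i, by omega, hidx s, ?_⟩
      have h1 := bitRev_gate_antitone hG (show i + (k + 1) ≤ J by omega) hk'.2
      convert h1 using 1
      rw [bitRev_eq_iff, clock_eq_mod (n := ρ) fun l _ => rfl]
      refine ((Nat.mod_modEq _ _).add_right _).trans ?_
      have h2 : ρ + (i + (k + 1)) = r + (k + 1) + i * 2 ^ J := by
        have : 2 ^ J - 1 + 1 = 2 ^ J := Nat.sub_add_cancel Nat.one_le_two_pow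
        simp only [ρ]
        rw [← this]
        simp only [Nat.add_sub_cancel]
        ring
      rw [h2]
      have h3 : i * 2 ^ J ≡ 0 [MOD 2 ^ (i + (k + 1))] :=
        Nat.modEq_zero_iff_dvd.2 (Dvd.dvd.mul_left (pow_dvd_pow 2 (by omega)) _)
      exact h3.add_left _
  funext k
  have hkn := Finset.mem_range.1 (Finset.mem_filter.1 k.2).1
  rw [← hread s k, ← hread t k, hst k hkn i (by omega)]

open Classical in
theorem le_cylEntropy_gatedShift [Finite B]
    (hG : ∀ i j v, ∀ e < 2, G i (j + 1) (2 * v + e) → G i j v) {C : ℕ} (hB : Nat.card B = 2 ^ C)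
    {i : ℕ} {t : ℝ} (ht : ∀ J, 2 ^ J * t ≤ C * (Nat.count (G i J) (2 ^ J) : ℕ)) :
    t ≤ cylEntropy (gatedShift G b₀) (i + 1) := by
  refine le_ciInf fun n => ?_
  have hn : (0 : ℝ) < (n : ℝ) + 1 := by positivity
  rw [le_div_iff₀ hn]
  set J := i + (n + 1) with hJ
  obtain ⟨r, hr⟩ := exists_le_count_shift (P := fun k => G i J (bitRev J k)) (Nat.two_pow_pos J)
    (fun r => count_bitRev (P := G i J) J r) (n + 1)
  set N := Nat.count (fun k => G i J (bitRev J (r + k))) (n + 1) with hN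
  have h1 := le_itinCount_gatedShift (b₀ := b₀) hG i (n + 1) r
  rw [← hJ, ← hN, hB, ← pow_mul] at h1
  have h2 : ((C * N : ℕ) : ℝ) ≤ Real.logb 2 (itinCount (gatedShift G b₀) (i + 1) (n + 1) : ℝ) := by
    have h3 : (2 : ℝ) ^ (C * N) ≤ (itinCount (gatedShift G b₀) (i + 1) (n + 1) : ℝ) := by
      exact_mod_cast h1
    have h4 := Real.logb_le_logb_of_le (by norm_num : (1 : ℝ) < 2) (by positivity) h3
    rwa [Real.logb_pow, Real.logb_self_eq_one (by norm_num), mul_one] at h4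
  refine le_trans ?_ h2
  have h5 : ((n : ℝ) + 1) * (Nat.count (G i J) (2 ^ J) : ℕ) ≤ 2 ^ J * (N : ℝ) := by
    exact_mod_cast hr
  have hJ0 : (0 : ℝ) < 2 ^ J := by positivity
  refine le_of_mul_le_mul_left ?_ hJ0
  calc 2 ^ J * (t * ((n : ℝ) + 1)) = (2 ^ J * t) * ((n : ℝ) + 1) := by ring
    _ ≤ (C * (Nat.count (G i J) (2 ^ J) : ℕ)) * ((n : ℝ) + 1) :=
      mul_le_mul_of_nonneg_right (ht J) hn.le
    _ = C * (((n : ℝ) + 1) * (Nat.count (G i J) (2 ^ J) : ℕ)) := by ring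
    _ ≤ C * (2 ^ J * (N : ℝ)) := mul_le_mul_of_nonneg_left h5 (Nat.cast_nonneg _)
    _ = 2 ^ J * ((C * N : ℕ) : ℝ) := by push_cast; ring

open Classical in
-- Only the finitely many indices below `m` are visible in `m`-cylinders, so one level `J` serves
-- them all. With `J` fixed, the count of itineraries is at most `2^(n s + K)` with `K` independent
-- of `n`.
theorem cylEntropy_gatedShift_le [Finite B]
    (hG : ∀ i j v, ∀ e < 2, G i (j + 1) (2 * v + e) → G i j v) {C : ℕ} (hB : Nat.card B = 2 ^ C)
    {m : ℕ} {s : ℝ} (hs : 0 ≤ s)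
    (h : ∀ i < m, ∀ᶠ J in atTop, C * ((Nat.count (G i J) (2 ^ J) : ℕ) : ℝ) ≤ 2 ^ J * s) :
    cylEntropy (gatedShift G b₀) m ≤ s := by
  have : Nonempty B := ⟨b₀⟩
  have h' : ∀ᶠ J in atTop, ∀ i ∈ Finset.range m,
      C * ((Nat.count (G i J) (2 ^ J) : ℕ) : ℝ) ≤ 2 ^ J * s :=
    (Finset.eventually_all _).2 fun i hi => h i (Finset.mem_range.1 hi)
  obtain ⟨J, hJ, hmJ⟩ := (h'.and (eventually_ge_atTop m)).exists
  let M : ℕ := (Finset.range m).sup fun i => Nat.count (G i J) (2 ^ J)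
  have hM : (C : ℝ) * M ≤ 2 ^ J * s := by
    rcases Nat.eq_zero_or_pos m with rfl | hm
    · simp only [M, Finset.range_zero, Finset.sup_empty, bot_eq_zero, Nat.cast_zero, mul_zero]
      positivity
    · obtain ⟨i, hi, hiM⟩ := Finset.exists_mem_eq_sup (Finset.range m) ⟨0, by simpa using hm⟩
        fun i => Nat.count (G i J) (2 ^ J)
      simp only [M, hiM]
      exact hJ i hi
  let K : ℝ := m + J + C * J + C * J + m * s + 2 ^ J * s
  have hK : 0 ≤ K := by positivity
  have hbound : ∀ n : ℕ, Real.logb 2 (itinCount (gatedShift G b₀) m n : ℝ) ≤ n * s + K := by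
    intro n
    let D := J + ((n + m) / 2 ^ J + 1) * M
    have h1 := itinCount_gatedShift_le (b₀ := b₀) hG (n := n) (D := D) hmJ (Nat.le_add_right _ _)
      fun i hi r => Nat.add_le_add_left ((count_shift_le (P := fun k => G i J (bitRev J k))
        (Nat.two_pow_pos J) (fun r => count_bitRev (P := G i J) J r) r (n + m)).trans
        (Nat.mul_le_mul_left _ (Finset.le_sup (f := fun i => Nat.count (G i J) (2 ^ J))
          (Finset.mem_range.2 hi)))) J
    rw [hB, ← pow_mul, ← pow_mul, ← pow_add, ← pow_add, ← pow_add] at h1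
    have h2 : (itinCount (gatedShift G b₀) m n : ℝ) ≤ 2 ^ (m + (J + (C * J + C * D))) := by
      exact_mod_cast h1
    have h0 : (0 : ℝ) < itinCount (gatedShift G b₀) m n := by
      exact_mod_cast itinCount_pos _ m n
    have h3 := Real.logb_le_logb_of_le (by norm_num : (1 : ℝ) < 2) h0 h2
    rw [Real.logb_pow, Real.logb_self_eq_one (by norm_num), mul_one] at h3
    refine h3.trans ?_
    have h4 : (((n + m) / 2 ^ J : ℕ) : ℝ) * 2 ^ J ≤ n + m := by
      exact_mod_cast Nat.div_mul_le_self (n + m) (2 ^ J)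
    have h5 : (C : ℝ) * D ≤ C * J + ((n + m) * s + 2 ^ J * s) := by
      simp only [D]
      push_cast
      calc (C : ℝ) * (J + ((((n + m) / 2 ^ J : ℕ) : ℝ) + 1) * M)
          = C * J + ((((n + m) / 2 ^ J : ℕ) : ℝ) + 1) * (C * M) := by ring
        _ ≤ C * J + ((((n + m) / 2 ^ J : ℕ) : ℝ) + 1) * (2 ^ J * s) := by gcongr
        _ = C * J + ((((n + m) / 2 ^ J : ℕ) : ℝ) * 2 ^ J * s + 2 ^ J * s) := by ring
        _ ≤ C * J + ((n + m) * s + 2 ^ J * s) := by gcongr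
    push_cast
    simp only [K]
    linarith
  refine le_of_forall_pos_le_add fun ε hε => ?_
  obtain ⟨n, hn⟩ := exists_nat_gt (K / ε)
  refine (cylEntropy_le _ m n).trans ?_
  rw [div_le_iff₀ (by positivity)]
  have h6 := hbound (n + 1)
  rw [div_lt_iff₀ hε] at hn
  push_cast at h6
  nlinarith

end GatedShiftEntropy

/-! ### Gates from a computable double sequence -/

section Gates

/-- `v / 2 ^ j < x / C`, where `x` is the rational number with code `d`. -/
def IsBelow (C j v : ℕ) (d : ℕ × ℕ × ℕ) : Prop :=
  v * (C * (d.2.2 + 1)) + 2 ^ j * d.2.1 < 2 ^ j * d.1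

theorem isBelow_iff {C j v : ℕ} {d : ℕ × ℕ × ℕ} :
    IsBelow C j v d ↔ (v : ℝ) * C < 2 ^ j * ((ratOfCode d : ℚ) : ℝ) := by
  have h : ((ratOfCode d : ℚ) : ℝ) = ((d.1 : ℝ) - d.2.1) / ((d.2.2 : ℝ) + 1) := by
    simp [ratOfCode]
  rw [h, mul_div_assoc', lt_div_iff₀ (by positivity), mul_sub, lt_sub_iff_add_lt, IsBelow,
    mul_assoc]
  exact_mod_cast Iff.rfl

/-- Every value of `g i` known at stage `j` exceeds `C * v / 2 ^ j`. -/
def IsBelowAll (C : ℕ) (g : (ℕ × ℕ) × ℕ → Option (ℕ × ℕ × ℕ)) (i j v : ℕ) : Prop :=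
  ∀ l < j + 1, g ((i, l.unpair.1), l.unpair.2) = none ∨
    IsBelow C j v ((g ((i, l.unpair.1), l.unpair.2)).getD (0, 0, 0))

variable {C : ℕ} {g : (ℕ × ℕ) × ℕ → Option (ℕ × ℕ × ℕ)}

theorem isBelowAll_iff {i j v : ℕ} : IsBelowAll C g i j v ↔
    ∀ l < j + 1, ∀ d, g ((i, l.unpair.1), l.unpair.2) = some d → IsBelow C j v d := by
  refine forall₂_congr fun l _ => ?_
  rcases g ((i, l.unpair.1), l.unpair.2) with _ | d
  · simp
  · simp

theorem primrecPred_isBelowAll (hg : Primrec g) :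
    PrimrecPred fun q : ℕ × ℕ × ℕ => IsBelowAll C g q.1 q.2.1 q.2.2 := by
  have hB : PrimrecPred fun q : (ℕ × ℕ) × ℕ × ℕ × ℕ => IsBelow C q.1.1 q.1.2 q.2 := by
    have hj : Primrec fun q : (ℕ × ℕ) × ℕ × ℕ × ℕ => 2 ^ q.1.1 :=
      primrec_two_pow.comp (Primrec.fst.comp Primrec.fst)
    have hv : Primrec fun q : (ℕ × ℕ) × ℕ × ℕ × ℕ => q.1.2 := Primrec.snd.comp Primrec.fst
    have ha : Primrec fun q : (ℕ × ℕ) × ℕ × ℕ × ℕ => q.2.1 := Primrec.fst.comp Primrec.snd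
    have hb : Primrec fun q : (ℕ × ℕ) × ℕ × ℕ × ℕ => q.2.2.1 :=
      Primrec.fst.comp (Primrec.snd.comp Primrec.snd)
    have hc : Primrec fun q : (ℕ × ℕ) × ℕ × ℕ × ℕ => q.2.2.2 + 1 :=
      Primrec.succ.comp (Primrec.snd.comp (Primrec.snd.comp Primrec.snd))
    exact Primrec.nat_lt.comp (Primrec.nat_add.comp
      (Primrec.nat_mul.comp hv (Primrec.nat_mul.comp (Primrec.const C) hc))
      (Primrec.nat_mul.comp hj hb)) (Primrec.nat_mul.comp hj ha)
  have hu : Primrec fun q : ℕ × ℕ × ℕ × ℕ => g ((q.2.1, q.1.unpair.1), q.1.unpair.2) := by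
    have h1 : Primrec fun q : ℕ × ℕ × ℕ × ℕ => q.1.unpair := Primrec.unpair.comp Primrec.fst
    exact hg.comp (((Primrec.fst.comp Primrec.snd).pair (Primrec.fst.comp h1)).pair
      (Primrec.snd.comp h1))
  have hR : PrimrecRel fun (l : ℕ) (q : ℕ × ℕ × ℕ) =>
      g ((q.1, l.unpair.1), l.unpair.2) = none ∨
        IsBelow C q.2.1 q.2.2 ((g ((q.1, l.unpair.1), l.unpair.2)).getD (0, 0, 0)) := by
    refine PrimrecPred.or (Primrec.eq.comp hu (Primrec.const none)) ?_
    exact hB.comp ((Primrec.snd.comp Primrec.snd).pair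
      (Primrec.option_getD.comp hu (Primrec.const (0, 0, 0))))
  exact primrecPred_forall_lt hR (Primrec.succ.comp (Primrec.fst.comp Primrec.snd))

/-- Going down a level drops constraints, and the dyadic number can only decrease: `2 v / 2^(j+1) ≤
(2 v + e) / 2^(j+1)`. -/
theorem IsBelowAll.of_succ {i j v e : ℕ} (h : IsBelowAll C g i (j + 1) (2 * v + e)) :
    IsBelowAll C g i j v := by
  rw [isBelowAll_iff] at h ⊢
  intro l hl d hd
  have h1 := h l (by omega) d hd
  rw [isBelow_iff] at h1 ⊢
  push_cast [pow_succ] at h1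
  have h2 : (0 : ℝ) ≤ (e : ℝ) * C := by positivity
  linarith

variable {q : ℕ × ℕ → ℕ × ℕ × ℕ}

open Classical in
-- Once `J ≥ Nat.pair j s`, the gate takes the value `q (i, j)` into account; the rounding error `C
-- / 2^J` is absorbed by `y - x`.
theorem eventually_count_isBelowAll_le (hC : 0 < C)
    (hg : ∀ a, ∃ s, g (a, s) = some (q a)) {i j : ℕ} {x y : ℝ} (hx : 0 ≤ x) (hxy : x < y)
    (hq : ((ratOfCode (q (i, j)) : ℚ) : ℝ) ≤ x) :
    ∀ᶠ J in atTop, C * ((Nat.count (IsBelowAll C g i J) (2 ^ J) : ℕ) : ℝ) ≤ 2 ^ J * y := by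
  obtain ⟨s, hs⟩ := hg (i, j)
  have hC' : (0 : ℝ) < C := by exact_mod_cast hC
  obtain ⟨N, hN⟩ := pow_unbounded_of_one_lt (C / (y - x)) (by norm_num : (1 : ℝ) < 2)
  filter_upwards [eventually_ge_atTop (Nat.pair j s), eventually_ge_atTop N] with J hJ hNJ
  have h1 : Nat.count (IsBelowAll C g i J) (2 ^ J) ≤ ⌈2 ^ J * x / C⌉₊ := by
    rw [Nat.count_eq_card_filter_range, ← Finset.card_range ⌈2 ^ J * x / C⌉₊]
    refine Finset.card_le_card fun v hv => Finset.mem_range.2 (Nat.lt_ceil.2 ?_)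
    have h2 := isBelowAll_iff.1 (Finset.mem_filter.1 hv).2 (Nat.pair j s) (by omega)
      (q (i, j)) (by simpa using hs)
    rw [isBelow_iff] at h2
    rw [lt_div_iff₀ hC']
    exact h2.trans_le (by gcongr)
  have h3 : ((Nat.count (IsBelowAll C g i J) (2 ^ J) : ℕ) : ℝ) ≤ 2 ^ J * x / C + 1 :=
    (Nat.cast_le.2 h1).trans (Nat.ceil_lt_add_one (by positivity)).le
  have h4 : (C : ℝ) ≤ 2 ^ J * (y - x) := by
    rw [div_lt_iff₀ (sub_pos.2 hxy)] at hN
    refine hN.le.trans (mul_le_mul_of_nonneg_right ?_ (sub_pos.2 hxy).le)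
    exact pow_le_pow_right₀ (by norm_num) hNJ
  calc (C : ℝ) * ((Nat.count (IsBelowAll C g i J) (2 ^ J) : ℕ) : ℝ)
      ≤ C * (2 ^ J * x / C + 1) := by gcongr
    _ = 2 ^ J * x + C := by field_simp
    _ ≤ 2 ^ J * y := by linarith

open Classical in
-- Every `v < 2^J t / C` passes, because all revealed values are at least `t`; `t ≤ C` keeps such
-- `v` below `2^J`.
theorem le_count_isBelowAll (hC : 0 < C) (hg : ∀ a s d, g (a, s) = some d → d = q a)
    {i : ℕ} {t : ℝ} (htC : t ≤ C) (ht : ∀ j, t ≤ ((ratOfCode (q (i, j)) : ℚ) : ℝ)) (J : ℕ) :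
    2 ^ J * t ≤ C * ((Nat.count (IsBelowAll C g i J) (2 ^ J) : ℕ) : ℝ) := by
  have hC' : (0 : ℝ) < C := by exact_mod_cast hC
  have h1 : ⌈2 ^ J * t / C⌉₊ ≤ Nat.count (IsBelowAll C g i J) (2 ^ J) := by
    rw [Nat.count_eq_card_filter_range, ← Finset.card_range ⌈2 ^ J * t / C⌉₊]
    refine Finset.card_le_card fun v hv => ?_
    have hv' := Nat.lt_ceil.1 (Finset.mem_range.1 hv)
    rw [lt_div_iff₀ hC'] at hv'
    refine Finset.mem_filter.2 ⟨Finset.mem_range.2 ?_, isBelowAll_iff.2 fun l _ d hd => ?_⟩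
    · have h2 : (v : ℝ) * C < 2 ^ J * C := hv'.trans_le (by gcongr)
      exact_mod_cast lt_of_mul_lt_mul_right h2 hC'.le
    · rw [isBelow_iff, hg _ _ _ hd]
      exact hv'.trans_le (mul_le_mul_of_nonneg_left (ht _) (by positivity))
  have h3 : 2 ^ J * t / C ≤ ((Nat.count (IsBelowAll C g i J) (2 ^ J) : ℕ) : ℝ) :=
    (Nat.le_ceil _).trans (Nat.cast_le.2 h1)
  rwa [div_le_iff₀' hC'] at h3

theorem IsSigmaTwo.exists_system {h : ℝ} (hh : 0 ≤ h) (hσ : IsSigmaTwo h) :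
    ∃ (A : Type) (_ : Finite A) (_ : Primcodable A) (a : A) (f : CantorSpace A → CantorSpace A),
      IsComputableSystem (cantorComp A a) Set.univ f ∧ topEntropy Set.univ f = (h : EReal) := by
  classical
  obtain ⟨r, ⟨q, hq, hrq⟩, hsup⟩ := hσ
  obtain ⟨g, hgp, hg1, hg2⟩ := hq.exists_stage
  obtain ⟨C, hC⟩ := exists_nat_gt h
  have hC0 : 0 < C := by exact_mod_cast hh.trans_lt hC
  let B := Fin (2 ^ C)
  have hB : Nat.card B = 2 ^ C := Nat.card_fin _
  let b₀ : B := ⟨0, Nat.two_pow_pos C⟩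
  let a : Bool × Bool × B := (false, false, b₀)
  let f := gatedShift (IsBelowAll C g) b₀
  have hG : ∀ i j v, ∀ e < 2, IsBelowAll C g i (j + 1) (2 * v + e) → IsBelowAll C g i j v :=
    fun i j v e _ hb => hb.of_succ
  have hf : Continuous f := continuous_of_local fun x y p hxy => gatedShift_congr hxy
  have : Nonempty (Bool × Bool × B) := ⟨a⟩
  refine ⟨Bool × Bool × B, inferInstance, inferInstance, a, f, ⟨⟨hf, isCompact_univ,
    Set.mapsTo_univ _ _⟩, isComputableMap_gatedShift (primrecPred_isBelowAll hgp) b₀ a, ?_⟩, ?_⟩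
  · refine ⟨∅, PrimrecPred.to_re ⟨fun _ => Decidable.isFalse id, ?_⟩, by simp [ballUnion]⟩
    exact Primrec.const false
  rw [topEntropy_eq_iSup hf]
  refine le_antisymm (iSup_le fun m => EReal.coe_le_coe_iff.2 ?_) (le_of_forall_lt fun y hy => ?_)
  · refine le_of_forall_pos_le_add fun ε hε => ?_
    refine cylEntropy_gatedShift_le hG hB (by positivity) fun i _ => ?_
    have h1 : ⨅ j, ((r (i, j) : ℝ) : EReal) < ((h + ε / 2 : ℝ) : EReal) := by
      refine lt_of_le_of_lt ?_ (EReal.coe_lt_coe_iff.2 (lt_add_of_pos_right h (half_pos hε)))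
      rw [hsup]
      exact le_iSup (fun i => ⨅ j, ((r (i, j) : ℝ) : EReal)) i
    obtain ⟨j, hj⟩ := iInf_lt_iff.1 h1
    rw [EReal.coe_lt_coe_iff, hrq] at hj
    exact eventually_count_isBelowAll_le hC0 hg2 (by positivity) (by linarith) hj.le
  · obtain ⟨t, hyt, hth⟩ := EReal.lt_iff_exists_real_btwn.1 hy
    have htC : t ≤ C := (EReal.coe_lt_coe_iff.1 hth).le.trans hC.le
    rw [hsup] at hth
    obtain ⟨i, hi⟩ := lt_iSup_iff.1 hth
    have ht : ∀ j, t ≤ ((ratOfCode (q (i, j)) : ℚ) : ℝ) := fun j => by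
      rw [← hrq]
      exact EReal.coe_le_coe_iff.1 (hi.le.trans (iInf_le _ j))
    refine hyt.trans_le (le_trans (EReal.coe_le_coe_iff.2 ?_)
      -- Cylinders of length `i + 1` are needed to see column `i`, where the letters are read.
      (le_iSup (fun m => (cylEntropy f m : EReal)) (i + 1)))
    exact le_cylEntropy_gatedShift hG hB (le_count_isBelowAll hC0 hg1 htC ht)

end Gates

end CompDyn

theorem mainTheorem6 (h : ℝ) (hh : 0 ≤ h) :
    (∃ (A : Type) (_ : Finite A) (_ : Primcodable A) (a : A)
        (f : CompDyn.CantorSpace A → CompDyn.CantorSpace A),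
      CompDyn.IsComputableSystem (CompDyn.cantorComp A a) Set.univ f ∧
        CompDyn.topEntropy Set.univ f = (h : EReal)) ↔
      CompDyn.IsSigmaTwo h := by
  refine ⟨?_, fun hσ => hσ.exists_system hh⟩
  rintro ⟨A, _, _, a, f, hf, hh'⟩
  exact CompDyn.isSigmaTwo_of_topEntropy_eq hf.isDynamicalSystem.continuous hf.computable hh'
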